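/- Let $\alpha>-1$ be real with $\alpha\notin\{0,1,2,\dots\}$, let $n\ge 1$ be an integer, and let $w(t)=t^{\alpha}e^{-t}$. Let $$L_k^\alpha(x)=\sum_{i=0}^{k}(-1)^i\binom{k+\alpha}{k-i}\frac{x^i}{i!},\qquad \Phi(a,c;x)=\sum_{i\ge 0}\frac{(a)_i}{(c)_i}\frac{x^i}{i!}$$ be the Laguerre polynomials and the confluent hypergeometric function, where $(a)_i=a(a+1)\cdots(a+i-1)$, and for $x>0$ put $$Q_n^\alpha(x)=\frac{\Gamma(\alpha)}{\pi}e^{-x}\Phi(-n-\alpha,1-\alpha;x)-\cot(\pi\alpha)\,x^\alpha e^{-x}L_n^\alpha(x).$$ The polynomial $L_n^\alpha$ has exactly $n$ distinct real zeros $x_1<\dots<x_n$, all positive, and $L_{n-1}^\alpha(x_m)\ne 0$ for every $m$. Put $$\gamma_m=-\frac{x_m}{(n+\alpha)L_{n-1}^\alpha(x_m)},\qquad m=1,\dots,n.$$ Let $f$ be a real function on $[0,\infty)$ that is Hölder continuous on every interval $[0,a]$, $a>0$, and satisfies $|f(x)|\le Ce^{\beta x}$ for all sufficiently large $x$, with some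 constants $C$ and $\beta<1$. Then the principal value $$I^\alpha[f](x)=\frac1\pi\,\mathrm{p.v.}\!\int_0^\infty\frac{f(t)w(t)}{t-x}\,dt$$ exists for every $x>0$. Define the remainder $R_n(x)$, $x>0$, by $$I^\alpha[f](x)=\sum_{m=1}^n\gamma_m f(x_m)\frac{Q_n^\alpha(x)-Q_n^\alpha(x_m)}{x-x_m}+R_n(x),\qquad x\ne x_1,\dots,x_n,$$ and, at the nodes, by $$I^\alpha[f](x_j)=\gamma_j f(x_j)\frac{dQ_n^\alpha}{dx}(x_j)+\sum_{m\ne j}\gamma_m f(x_m)\frac{Q_n^\alpha(x_j)-Q_n^\alpha(x_m)}{x_j-x_m}+R_n(x_j),$$ where $Q_n^\alpha$ is differentiable at $x_j$ with $$\frac{dQ_n^\alpha}{dx}(x_j)=\frac{1}{\pi}e^{-x_j}\Gamma(\alpha)\left[\frac{n+\alpha}{\alpha-1}\Phi(-n-\alpha+1,2-\alpha;x_j)-\Phi(-n-\alpha,1-\alpha;x_j)\right]+\cot(\pi\alpha)\,x_j^{\alpha-1}e^{-x_j}(n+\alpha)L_{n-1}^\alpha(x_j).$$ Then: 1. If $f$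 is a polynomial of degree at most $n-1$, then $R_n(x)=0$ for all $x>0$. 2. If $f=M+r$ on $[0,\infty)$ with $M$ a polynomial of degree at most $n-1$, then $I^\alpha[r](x)$ exists for every $x>0$. For $x>0$, $x\neq x_1,\dots,x_n$, $$R_n(x)=-\sum_{m=1}^n\frac{\gamma_m r(x_m)}{x-x_m}\left[Q_n^\alpha(x)-Q_n^\alpha(x_m)\right]+\frac1\pi\,\mathrm{p.v.}\!\int_0^\infty\frac{r(t)w(t)}{t-x}\,dt,$$ and at a node $x=x_j$ the same formula holds with the quotient $\frac{Q_n^\alpha(x)-Q_n^\alpha(x_m)}{x-x_m}$ for $m=j$ replaced by $\frac{dQ_n^\alpha}{dx}(x_j)$. -/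

import Mathlib

open Real Set Filter Topology MeasureTheory Polynomial

noncomputable section

/-- The generalized Laguerre polynomial
`L_n^α(x) = ∑_{k=0}^n (-1)^k binom(n+α, n-k) x^k / k!`, where for `α > -1`
`binom(n+α, n-k) = Γ(n+α+1) / (Γ(α+k+1) (n-k)!)`. -/
def laguerreL (n : ℕ) (α : ℝ) : ℝ[X] :=
  ∑ k ∈ Finset.range (n + 1),
    C ((-1) ^ k * (Real.Gamma (n + α + 1) / (Real.Gamma (α + k + 1) * (n - k).factorial))
      / k.factorial) * X ^ k

/-- The confluent hypergeometric (Kummer) function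
`Φ(a, c; x) = ∑_{k ≥ 0} (a)_k / (c)_k * x^k / k!`; the series converges for every real `x` when `c`
is not one of `0, -1, -2, …`. -/
def kummerPhi (a c x : ℝ) : ℝ :=
  ∑' k : ℕ, (ascPochhammer ℝ k).eval a / (ascPochhammer ℝ k).eval c * x ^ k / k.factorial

/-- The weight `w(t) = t^α e^{-t}` on the positive semi-axis. -/
def laguerreWeight (α t : ℝ) : ℝ := t ^ α * exp (-t)

/-- The integral of `g(t)/(t-x)` over the positive semi-axis with the interval `(x-ε, x+ε)`
removed. -/
def truncCauchy (g : ℝ → ℝ) (x ε : ℝ) : ℝ :=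
  ∫ t in Ioi 0 \ Ioo (x - ε) (x + ε), g t / (t - x)

/-- The principal value of the integral of `g(t)/(t-x)` over the positive semi-axis exists and
equals `v`. All truncated integrals are required to converge absolutely. -/
def HasCauchyPV (g : ℝ → ℝ) (x v : ℝ) : Prop :=
  (∀ ε > 0, IntegrableOn (fun t => g t / (t - x)) (Ioi 0 \ Ioo (x - ε) (x + ε))) ∧
    Tendsto (truncCauchy g x) (𝓝[>] 0) (𝓝 v)

/-- The principal value of the integral of `g(t)/(t-x)` over the positive semi-axis
(meaningful only where it exists, see `HasCauchyPV`). -/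
def cauchyPV (g : ℝ → ℝ) (x : ℝ) : ℝ := limUnder (𝓝[>] 0) (truncCauchy g x)

/-- The Cauchy integral `I^α[f](x) = (1/π) p.v. ∫_0^∞ f(t) w(t) / (t-x) dt`. -/
def cauchyI (α : ℝ) (f : ℝ → ℝ) (x : ℝ) : ℝ :=
  1 / π * cauchyPV (fun t => f t * laguerreWeight α t) x

/-- `Q_n^α(x) = (Γ(α)/π) e^{-x} Φ(-n-α, 1-α; x) - cot(πα) x^α e^{-x} L_n^α(x)`. -/
def laguerreQ (n : ℕ) (α x : ℝ) : ℝ :=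
  Real.Gamma α / π * exp (-x) * kummerPhi (-n - α) (1 - α) x
    - Real.cot (π * α) * x ^ α * exp (-x) * (laguerreL n α).eval x

/-- The weight `-y / ((n+α) L_{n-1}^α(y))` attached to a node `y`. -/
def quadGamma (n : ℕ) (α y : ℝ) : ℝ :=
  -y / ((n + α) * (laguerreL (n - 1) α).eval y)

/-- The remainder `R_n(y)` : the Cauchy integral of `f` minus the quadrature sum with nodes
`x 0, …, x (n-1)`. Here `dslope Q a y` is the divided difference `(Q y - Q a) / (y - a)` if `y ≠ a`
and the derivative of `Q` at `a` if `y = a`. -/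
def quadRemainder (n : ℕ) (α : ℝ) (x : Fin n → ℝ) (f : ℝ → ℝ) (y : ℝ) : ℝ :=
  cauchyI α f y - ∑ m, quadGamma n α (x m) * f (x m) * dslope (laguerreQ n α) (x m) y

end

/-! Everything rests on one closed form: the principal value of `L_n^α w` against `1/(t-x)` is `π
Q_n^α(x)` (`hasCauchyPV_laguerreL`). Let `q_m = L_n^α/(t-x_m)`, with Cauchy principal value `v(y)`.
Writing `t-x_m = (t-y) + (y-x_m)` gives `π Q(y) = ∫ q_m w + (y-x_m) v(y)`. At `y = x_m` this
identifies the constant as `π Q(x_m)`, so `v(y)/π` is the divided difference of `Q`, and by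
continuity of `v` its derivative at the node. Moreover `γ_m = 1/L_n'(x_m)`, so Lagrange
interpolation reads `P = ∑ γ_m P(x_m) q_m`, and integrating it is exactness. The formula for `f = M
+ r` is then linearity.

The closed form starts from the weight alone. For `-1 < α < 0`, dilate the pole to `1` and split
`e^{-x(u-1)} = 1 + (e^{-x(u-1)} - 1)`. The pure power contributes `-π cot(πα)` by the partial
fractions of the cotangent; the regular part becomes a Kummer series by Fubini. Multiplication by `t
= x + (t-x)` raises `α` by one, which reaches every non-integer `α > -1`. A recurrence in `(n, α)`,
matched with a contiguity relation for Kummer functions, then raises `n`.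

Existence for general `f` follows from `f(t) = f(y) + (f(t)-f(y))`, the second part being absolutely
integrable. The zeros of `L_n^α` come from repeated use of Rolle's theorem. -/

/-! ### Calculus of principal values -/

theorem measurableSet_truncation (x ε : ℝ) : MeasurableSet (Ioi (0 : ℝ) \ Ioo (x - ε) (x + ε)) :=
  measurableSet_Ioi.diff measurableSet_Ioo

theorem HasCauchyPV.cauchyPV_eq {g : ℝ → ℝ} {x v : ℝ} (h : HasCauchyPV g x v) :
    cauchyPV g x = v :=
  h.2.limUnder_eq

theorem HasCauchyPV.hasCauchyPV_cauchyPV {g : ℝ → ℝ} {x v : ℝ} (h : HasCauchyPV g x v) :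
    HasCauchyPV g x (cauchyPV g x) := by
  rw [h.cauchyPV_eq]; exact h

theorem HasCauchyPV.unique {g : ℝ → ℝ} {x v w : ℝ} (h : HasCauchyPV g x v)
    (h' : HasCauchyPV g x w) : v = w :=
  tendsto_nhds_unique h.2 h'.2

theorem HasCauchyPV.congr {g h : ℝ → ℝ} {x v : ℝ} (hg : HasCauchyPV g x v)
    (hgh : ∀ t > 0, g t = h t) : HasCauchyPV h x v := by
  have key : ∀ ε, EqOn (fun t => g t / (t - x)) (fun t => h t / (t - x))
      (Ioi 0 \ Ioo (x - ε) (x + ε)) := fun ε t ht => by simp only [hgh t ht.1]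
  refine ⟨fun ε hε => (hg.1 ε hε).congr_fun (key ε) (measurableSet_truncation x ε), ?_⟩
  refine hg.2.congr fun ε => setIntegral_congr_fun (measurableSet_truncation x ε) (key ε)

theorem HasCauchyPV.add {g h : ℝ → ℝ} {x v w : ℝ} (hg : HasCauchyPV g x v)
    (hh : HasCauchyPV h x w) : HasCauchyPV (fun t => g t + h t) x (v + w) := by
  refine ⟨fun ε hε => ?_, (hg.2.add hh.2).congr' ?_⟩
  · simp only [add_div]
    exact (hg.1 ε hε).add (hh.1 ε hε)
  · filter_upwards [self_mem_nhdsWithin] with ε hε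
    simp only [truncCauchy, add_div]
    rw [integral_add (hg.1 ε hε) (hh.1 ε hε)]

theorem HasCauchyPV.const_mul {g : ℝ → ℝ} {x v : ℝ} (hg : HasCauchyPV g x v) (c : ℝ) :
    HasCauchyPV (fun t => c * g t) x (c * v) := by
  refine ⟨fun ε hε => ?_, (hg.2.const_mul c).congr fun ε => ?_⟩
  · simp only [mul_div_assoc]
    exact (hg.1 ε hε).const_mul c
  · simp only [truncCauchy, mul_div_assoc]
    rw [integral_const_mul]

theorem HasCauchyPV.sub {g h : ℝ → ℝ} {x v w : ℝ} (hg : HasCauchyPV g x v)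
    (hh : HasCauchyPV h x w) : HasCauchyPV (fun t => g t - h t) x (v - w) := by
  have := hg.add (hh.const_mul (-1))
  simp only [neg_one_mul, ← sub_eq_add_neg] at this
  exact this

theorem hasCauchyPV_of_integrableOn {g : ℝ → ℝ} {x : ℝ}
    (hg : IntegrableOn (fun t => g t / (t - x)) (Ioi 0)) :
    HasCauchyPV g x (∫ t in Ioi 0, g t / (t - x)) := by
  refine ⟨fun ε _ => hg.mono_set sdiff_subset, ?_⟩
  have h1 : ∀ ε, truncCauchy g x ε = ∫ t in Ioi 0,
      (Ioo (x - ε) (x + ε))ᶜ.indicator (fun t => g t / (t - x)) t := fun ε => by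
    rw [setIntegral_indicator measurableSet_Ioo.compl, truncCauchy, sdiff_eq]
  simp only [funext h1]
  refine tendsto_integral_filter_of_dominated_convergence (fun t => ‖g t / (t - x)‖) ?_ ?_
    hg.norm ?_
  · exact Eventually.of_forall fun ε =>
      hg.aestronglyMeasurable.indicator measurableSet_Ioo.compl
  · exact Eventually.of_forall fun ε => Eventually.of_forall fun t =>
      norm_indicator_le_norm_self _ _
  · have : ∀ᵐ t ∂(volume.restrict (Ioi (0 : ℝ))), t ≠ x := ae_restrict_of_ae (Measure.ae_ne volume x)
    filter_upwards [this] with t ht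
    have hpos : 0 < |t - x| := abs_pos.2 (sub_ne_zero.2 ht)
    refine tendsto_const_nhds.congr' ?_
    filter_upwards [Ioo_mem_nhdsGT hpos] with ε hε
    rw [indicator_of_mem]
    intro hmem
    have : |t - x| < ε := by rw [abs_lt]; constructor <;> linarith [hmem.1, hmem.2]
    exact absurd hε.2 (by linarith)

/-- The factor `t - x` cancels the pole almost everywhere. Every moment of the weight that appears
later enters through this lemma. -/
theorem hasCauchyPV_sub_mul {g : ℝ → ℝ} {x : ℝ} (hg : IntegrableOn g (Ioi 0)) :
    HasCauchyPV (fun t => (t - x) * g t) x (∫ t in Ioi 0, g t) := by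
  have hae : g =ᵐ[volume.restrict (Ioi 0)] fun t => (t - x) * g t / (t - x) := by
    have : ∀ᵐ t ∂(volume.restrict (Ioi (0 : ℝ))), t ≠ x := ae_restrict_of_ae (Measure.ae_ne volume x)
    filter_upwards [this] with t ht
    rw [mul_div_cancel_left₀ _ (sub_ne_zero.2 ht)]
  rw [integral_congr_ae hae]
  exact hasCauchyPV_of_integrableOn (hg.congr hae)

theorem HasCauchyPV.id_mul {g : ℝ → ℝ} {x v : ℝ} (h : HasCauchyPV g x v)
    (hg : IntegrableOn g (Ioi 0)) :
    HasCauchyPV (fun t => t * g t) x (x * v + ∫ t in Ioi 0, g t) :=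
  ((h.const_mul x).add (hasCauchyPV_sub_mul hg)).congr fun t _ => by ring

/-- The measure `dt/(t-x)` becomes `du/(u-1)` under `t = x u`, and the symmetric gap `ε` becomes
`ε/x`, which is again symmetric. -/
theorem HasCauchyPV.comp_div {g : ℝ → ℝ} {v : ℝ} (h : HasCauchyPV g 1 v) {x : ℝ} (hx : 0 < x) :
    HasCauchyPV (fun t => g (t / x)) x v := by
  have key : ∀ ε, (fun u => (Ioi 0 \ Ioo (x - ε) (x + ε)).indicator
        (fun t => g (t / x) / (t - x)) u)
      = fun u => x⁻¹ * (Ioi 0 \ Ioo (1 - ε / x) (1 + ε / x)).indicator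
        (fun t => g t / (t - 1)) (x⁻¹ * u) := by
    intro ε
    ext u
    have hmem : u ∈ Ioi 0 \ Ioo (x - ε) (x + ε) ↔
        x⁻¹ * u ∈ Ioi (0 : ℝ) \ Ioo (1 - ε / x) (1 + ε / x) := by
      have h1 : x⁻¹ * u = u / x := by ring
      have h2 : 1 - ε / x = (x - ε) / x := by field_simp
      have h3 : 1 + ε / x = (x + ε) / x := by field_simp
      simp only [Set.mem_sdiff, mem_Ioi, mem_Ioo, h1, h2, h3, div_lt_div_iff_of_pos_right hx,
        div_pos_iff_of_pos_right hx]
    by_cases hu : u ∈ Ioi 0 \ Ioo (x - ε) (x + ε)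
    · rw [indicator_of_mem hu, indicator_of_mem (hmem.1 hu)]
      rw [show x⁻¹ * u = u / x by ring, show u / x - 1 = (u - x) / x by field_simp]
      -- For `ε ≤ 0` the point `x` is not removed; there both quotients are zero by the convention
      -- for division by zero.
      rcases eq_or_ne u x with rfl | hne
      · simp
      · have := sub_ne_zero.2 hne
        field_simp
    · rw [indicator_of_notMem hu, indicator_of_notMem (fun h' => hu (hmem.2 h')), mul_zero]
  have hx' : x⁻¹ ≠ 0 := (inv_pos.2 hx).ne'
  refine ⟨fun ε hε => ?_, ?_⟩
  · rw [← integrable_indicator_iff (measurableSet_truncation x ε)]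
    have := (integrable_indicator_iff (measurableSet_truncation 1 (ε / x))).2
      (h.1 (ε / x) (div_pos hε hx))
    rw [show (Ioi 0 \ Ioo (x - ε) (x + ε)).indicator (fun t => g (t / x) / (t - x)) = _ from key ε]
    exact (this.comp_mul_left' hx').const_mul _
  · have h1 : truncCauchy (fun t => g (t / x)) x = fun ε => truncCauchy g 1 (ε / x) := by
      ext ε
      rw [truncCauchy, ← integral_indicator (measurableSet_truncation x ε),
        show (Ioi 0 \ Ioo (x - ε) (x + ε)).indicator (fun t => g (t / x) / (t - x)) = _ from key ε,
        integral_const_mul, Measure.integral_comp_mul_left, truncCauchy,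
        ← integral_indicator (measurableSet_truncation 1 (ε / x)), inv_inv, abs_of_pos hx,
        smul_eq_mul, ← mul_assoc, inv_mul_cancel₀ hx.ne', one_mul]
    rw [h1]
    refine h.2.comp (tendsto_nhdsWithin_iff.2 ⟨?_, ?_⟩)
    · have : Tendsto (fun ε : ℝ => ε / x) (𝓝 0) (𝓝 (0 / x)) :=
        tendsto_id.div_const x
      rw [zero_div] at this
      exact this.mono_left nhdsWithin_le_nhds
    · filter_upwards [self_mem_nhdsWithin] with ε hε using div_pos hε hx

/-! ### Principal value of a pure power and the cotangent -/

/-- The principal value at `1` of the indicator of `(0, 2)` vanishes by symmetry. -/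
theorem hasCauchyPV_indicator_Ioo : HasCauchyPV ((Ioo 0 2).indicator 1) 1 0 := by
  have hF : ∀ ε > 0, ∀ u, (Ioi 0 \ Ioo (1 - ε) (1 + ε)).indicator
      (fun t : ℝ => (Ioo (0 : ℝ) 2).indicator (1 : ℝ → ℝ) t / (t - 1)) u
      = (Ioo 0 2 \ Ioo (1 - ε) (1 + ε)).indicator (fun t : ℝ => (t - 1)⁻¹) u := by
    intro ε _ u
    simp only [indicator, Set.mem_sdiff, mem_Ioi, mem_Ioo, Pi.one_apply]
    split_ifs <;> simp_all
  refine ⟨fun ε hε => ?_, ?_⟩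
  · rw [← integrable_indicator_iff (measurableSet_truncation 1 ε), funext (hF ε hε),
      integrable_indicator_iff (measurableSet_Ioo.diff measurableSet_Ioo)]
    refine Measure.integrableOn_of_bounded (M := ε⁻¹) ?_ ?_ ?_
    · exact ((measure_mono sdiff_subset).trans_lt (by simp [Real.volume_Ioo])).ne
    · exact (by fun_prop : Measurable fun t : ℝ => (t - 1)⁻¹).aestronglyMeasurable
    · refine (ae_restrict_iff' (measurableSet_Ioo.diff measurableSet_Ioo)).2
        (Eventually.of_forall fun t ht => ?_)
      rw [norm_inv, Real.norm_eq_abs]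
      refine inv_anti₀ hε ?_
      by_contra hlt
      push Not at hlt
      rw [abs_lt] at hlt
      exact ht.2 ⟨by linarith, by linarith⟩
  · refine tendsto_const_nhds.congr' ?_
    filter_upwards [self_mem_nhdsWithin] with ε hε
    rw [truncCauchy, ← integral_indicator (measurableSet_truncation 1 ε), integral_congr_ae
      (Eventually.of_forall (hF ε hε))]
    -- The reflection `u ↦ 2 - u` preserves the truncated interval and negates the integrand, so the
    -- integral equals its own negative.
    have h1 := integral_sub_left_eq_self
      ((Ioo 0 2 \ Ioo (1 - ε) (1 + ε)).indicator (fun t : ℝ => (t - 1)⁻¹)) volume 2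
    have h2 : (fun u : ℝ => (Ioo 0 2 \ Ioo (1 - ε) (1 + ε)).indicator
          (fun t : ℝ => (t - 1)⁻¹) (2 - u))
        = fun u => - (Ioo 0 2 \ Ioo (1 - ε) (1 + ε)).indicator (fun t : ℝ => (t - 1)⁻¹) u := by
      ext u
      have hmem : 2 - u ∈ Ioo 0 2 \ Ioo (1 - ε) (1 + ε) ↔
          u ∈ Ioo 0 2 \ Ioo (1 - ε) (1 + ε) := by
        simp only [Set.mem_sdiff, mem_Ioo, not_and, not_lt]
        constructor
        · rintro ⟨⟨a, b⟩, c⟩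
          refine ⟨⟨by linarith, by linarith⟩, fun d => ?_⟩
          by_contra e
          linarith [c (by linarith)]
        · rintro ⟨⟨a, b⟩, c⟩
          refine ⟨⟨by linarith, by linarith⟩, fun d => ?_⟩
          by_contra e
          linarith [c (by linarith)]
      by_cases hu : u ∈ Ioo 0 2 \ Ioo (1 - ε) (1 + ε)
      · rw [indicator_of_mem hu, indicator_of_mem (hmem.2 hu), ← inv_neg]
        congr 1; ring
      · rw [indicator_of_notMem hu, indicator_of_notMem (fun h' => hu (hmem.1 h')), neg_zero]
    rw [h2, integral_neg] at h1
    linarith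

theorem setIntegral_Ioo_rpow {s : ℝ} (hs : -1 < s) : ∫ v in Ioo (0 : ℝ) 1, v ^ s = 1 / (s + 1) := by
  rw [← integral_Ioc_eq_integral_Ioo, ← intervalIntegral.integral_of_le zero_le_one,
    integral_rpow (Or.inl hs), one_rpow, zero_rpow (by linarith), sub_zero]

theorem integrableOn_Ioo_rpow {s : ℝ} (hs : -1 < s) :
    IntegrableOn (fun v : ℝ => v ^ s) (Ioo 0 1) :=
  (((intervalIntegrable_iff_integrableOn_Ioc_of_le zero_le_one).1
    (intervalIntegral.intervalIntegrable_rpow' hs)).mono_set Ioo_subset_Ioc_self)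

/-- After clearing the denominator, the upper bound says `v · v^(b-1) = v^b ≤ 1`. It provides an
integrable majorant on `(0, 1)`. -/
theorem rpow_sub_one_div_bounds {b v : ℝ} (hb : 0 < b) (hb1 : b < 1) (hv : v ∈ Ioo (0 : ℝ) 1) :
    0 ≤ (v ^ (b - 1) - 1) / (1 - v) ∧ (v ^ (b - 1) - 1) / (1 - v) ≤ v ^ (b - 1) := by
  have h1 : 0 < 1 - v := by linarith [hv.2]
  constructor
  · have h2 : b - 1 ≤ 0 := by linarith
    have h3 := one_le_rpow_of_pos_of_le_one_of_nonpos hv.1 hv.2.le h2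
    exact div_nonneg (by linarith) h1.le
  · rw [div_le_iff₀ h1]
    have : v * v ^ (b - 1) ≤ 1 := by
      rw [mul_comm, ← rpow_add_one hv.1.ne', sub_add_cancel]
      exact rpow_le_one hv.1.le hv.2.le hb.le
    linarith

theorem integrableOn_rpow_sub_one_div {b : ℝ} (hb : 0 < b) (hb1 : b < 1) :
    IntegrableOn (fun v : ℝ => (v ^ (b - 1) - 1) / (1 - v)) (Ioo 0 1) := by
  refine Integrable.mono' (integrableOn_Ioo_rpow (s := b - 1) (by linarith)) ?_ ?_
  · exact (by fun_prop : Measurable fun v : ℝ => (v ^ (b - 1) - 1) / (1 - v)).aestronglyMeasurable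
  · refine (ae_restrict_iff' measurableSet_Ioo).2 (Eventually.of_forall fun v hv => ?_)
    have := rpow_sub_one_div_bounds hb hb1 hv
    rw [Real.norm_eq_abs, abs_of_nonneg this.1]
    exact this.2

theorem hasSum_sub_of_tendsto_zero {u : ℕ → ℝ} (hu : Tendsto u atTop (𝓝 0))
    (hanti : Antitone u) : HasSum (fun k => u k - u (k + 1)) (u 0) := by
  rw [hasSum_iff_tendsto_nat_of_nonneg (fun k => sub_nonneg.2 (hanti (Nat.le_succ k)))]
  simp only [Finset.sum_range_sub']
  simpa using tendsto_const_nhds.sub hu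

/-- Comparison with the telescoping series of `1/(k+b) - 1/(k+1+b)`. -/
theorem summable_one_div_add_sub {b : ℝ} (hb : 0 < b) (hb1 : b < 1) :
    Summable fun k : ℕ => 1 / ((k : ℝ) + b) - 1 / (k + 1) := by
  have hsum := (hasSum_sub_of_tendsto_zero (u := fun k : ℕ => 1 / ((k : ℝ) + b))
    ?_ ?_).summable
  · refine hsum.of_nonneg_of_le (fun k => ?_) (fun k => ?_)
    · exact sub_nonneg.2 (one_div_le_one_div_of_le (by positivity) (by linarith))
    · push_cast
      exact sub_le_sub_left (one_div_le_one_div_of_le (by positivity) (by linarith)) _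
  · exact tendsto_const_nhds.div_atTop
      (tendsto_atTop_add_const_right _ _ tendsto_natCast_atTop_atTop)
  · intro m n hmn
    have : (m : ℝ) ≤ n := by exact_mod_cast hmn
    exact one_div_le_one_div_of_le (by positivity) (by linarith)

/-- Expand `1/(1-v)` as a geometric series. Since `b < 1`, each term `v^(k+b-1) - v^k` is
nonnegative, so its norm integrates to the same value and summability permits the exchange. -/
theorem hasSum_integral_rpow_sub_one_div {b : ℝ} (hb : 0 < b) (hb1 : b < 1) :
    HasSum (fun k : ℕ => 1 / ((k : ℝ) + b) - 1 / (k + 1))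
      (∫ v in Ioo (0 : ℝ) 1, (v ^ (b - 1) - 1) / (1 - v)) := by
  set F : ℕ → ℝ → ℝ := fun k v => v ^ ((k : ℝ) + b - 1) - v ^ (k : ℝ) with hF
  have hint : ∀ k, Integrable (F k) (volume.restrict (Ioo 0 1)) := fun k => by
    have hk : (0 : ℝ) ≤ k := k.cast_nonneg
    exact (integrableOn_Ioo_rpow (by linarith)).sub (integrableOn_Ioo_rpow (by linarith))
  have hval : ∀ k, ∫ v in Ioo 0 1, F k v = 1 / ((k : ℝ) + b) - 1 / (k + 1) := fun k => by
    have hk : (0 : ℝ) ≤ k := k.cast_nonneg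
    rw [hF, integral_sub (integrableOn_Ioo_rpow (by linarith)) (integrableOn_Ioo_rpow (by linarith)),
      setIntegral_Ioo_rpow (by linarith), setIntegral_Ioo_rpow (by linarith), sub_add_cancel]
  have hnorm : ∀ k, ∫ v in Ioo 0 1, ‖F k v‖ = 1 / ((k : ℝ) + b) - 1 / (k + 1) := fun k => by
    rw [← hval k]
    refine setIntegral_congr_fun measurableSet_Ioo fun v hv => ?_
    exact Real.norm_of_nonneg (sub_nonneg.2
      (rpow_le_rpow_of_exponent_ge (x := v) hv.1 hv.2.le (by linarith)))
  have key := hasSum_integral_of_summable_integral_norm hint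
    (by simpa only [hnorm] using summable_one_div_add_sub hb hb1)
  simp only [hval] at key
  refine (setIntegral_congr_fun measurableSet_Ioo fun v hv => ?_ :
    ∫ v in Ioo (0 : ℝ) 1, (v ^ (b - 1) - 1) / (1 - v) = ∫ v in Ioo 0 1, ∑' k, F k v) ▸ key
  have hg := (hasSum_geometric_of_lt_one (r := v) hv.1.le hv.2).mul_left (v ^ (b - 1) - 1)
  rw [← div_eq_mul_inv] at hg
  refine hg.tsum_eq.symm.trans (tsum_congr fun k => ?_)
  rw [hF]
  simp only
  rw [add_sub_assoc, rpow_add hv.1, rpow_natCast]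
  ring

/-- The Mittag-Leffler series groups the poles `±(k+1)`, whereas here `k` is grouped with `-(k+1)`.
The two groupings differ by the telescoping series of `1/(k-α)`. -/
theorem hasSum_cot {α : ℝ} (hα : -1 < α) (hα0 : α < 0) :
    HasSum (fun k : ℕ => 1 / ((k : ℝ) - α) - 1 / (k + (α + 1))) (-(π * Real.cot (π * α))) := by
  have hmem : (α : ℂ) ∈ Complex.integerComplement := by
    rintro ⟨m, hm⟩
    have hm' : (m : ℝ) = α := by exact_mod_cast hm
    rw [← hm'] at hα hα0
    have h1 : -1 < m := by exact_mod_cast hα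
    have h2 : m < 0 := by exact_mod_cast hα0
    omega
  have h1 := (summable_cotTerm hmem).hasSum
  simp only [cotTerm] at h1
  rw [← cot_series_rep' hmem] at h1
  have h2 : HasSum (fun n : ℕ => 1 / (α - ((n : ℝ) + 1)) + 1 / (α + ((n : ℝ) + 1)))
      (π * Real.cot (π * α) - 1 / α) := by
    rw [← Complex.hasSum_ofReal]
    push_cast
    exact h1
  have h3 := hasSum_sub_of_tendsto_zero (u := fun k : ℕ => 1 / ((k : ℝ) - α)) ?_ ?_
  · have h4 : (fun k : ℕ => 1 / ((k : ℝ) - α) - 1 / (k + (α + 1))) = fun k : ℕ =>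
        1 / ((k : ℝ) - α) - 1 / (((k + 1 : ℕ) : ℝ) - α)
          - (1 / (α - ((k : ℝ) + 1)) + 1 / (α + ((k : ℝ) + 1))) := by
      ext k
      have e1 : α - ((k : ℝ) + 1) = -((k : ℝ) + 1 - α) := by ring
      have e2 : α + ((k : ℝ) + 1) = k + (α + 1) := by ring
      rw [e1, e2]
      push_cast
      rw [one_div_neg_eq_neg_one_div]
      ring
    rw [h4]
    have h5 : -(π * Real.cot (π * α))
        = 1 / (((0 : ℕ) : ℝ) - α) - (π * Real.cot (π * α) - 1 / α) := by
      rw [Nat.cast_zero, zero_sub, one_div_neg_eq_neg_one_div]; ring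
    rw [h5]
    exact h3.sub h2
  · exact tendsto_const_nhds.div_atTop
      (tendsto_atTop_add_const_right _ (-α) tendsto_natCast_atTop_atTop)
  · intro m n hmn
    have : (m : ℝ) ≤ n := by exact_mod_cast hmn
    have h0 : (0 : ℝ) ≤ m := m.cast_nonneg
    exact one_div_le_one_div_of_le (by linarith) (by linarith)

theorem inv_image_Ioo_zero_one : (fun v : ℝ => v⁻¹) '' Ioo 0 1 = Ioi 1 := by
  ext u
  simp only [mem_image, mem_Ioo, mem_Ioi]
  constructor
  · rintro ⟨v, ⟨h0, h1⟩, rfl⟩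
    exact (one_lt_inv₀ h0).2 h1
  · intro hu
    exact ⟨u⁻¹, ⟨inv_pos.2 (by linarith), inv_lt_one_of_one_lt₀ hu⟩, inv_inv u⟩

theorem inv_change_of_variables (g : ℝ → ℝ) :
    (IntegrableOn g (Ioi 1) ↔ IntegrableOn (fun v => (v ^ 2)⁻¹ * g v⁻¹) (Ioo 0 1)) ∧
      ∫ u in Ioi 1, g u = ∫ v in Ioo 0 1, (v ^ 2)⁻¹ * g v⁻¹ := by
  have hd : ∀ v ∈ Ioo (0 : ℝ) 1, HasDerivWithinAt (fun v : ℝ => v⁻¹) (-(v ^ 2)⁻¹) (Ioo 0 1) v :=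
    fun v hv => (hasDerivAt_inv hv.1.ne').hasDerivWithinAt
  have hinj : InjOn (fun v : ℝ => v⁻¹) (Ioo 0 1) := inv_injective.injOn
  have habs : ∀ v : ℝ, |-(v ^ 2)⁻¹| = (v ^ 2)⁻¹ := fun v => by
    rw [abs_neg, abs_of_nonneg (by positivity)]
  rw [← inv_image_Ioo_zero_one]
  have e1 := integrableOn_image_iff_integrableOn_abs_deriv_smul measurableSet_Ioo hd hinj g
  have e2 := integral_image_eq_integral_abs_deriv_smul measurableSet_Ioo hd hinj g
  simp only [habs, smul_eq_mul] at e1 e2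
  exact ⟨e1, e2⟩

/-- The principal value of `∫ u ^ α / (u - 1)` over the positive semi-axis. -/
theorem hasCauchyPV_rpow_one {α : ℝ} (hα : -1 < α) (hα0 : α < 0) :
    HasCauchyPV (fun u => u ^ α) 1 (-(π * Real.cot (π * α))) := by
  -- Subtracting `h`, whose principal value at `1` is zero, removes the pole and leaves an ordinary
  -- integral. On `(1, ∞)` the auxiliary `u⁻¹` is inserted because inversion turns `(u^α -
  -- u⁻¹)/(u-1)` into the integrand already treated on `(0, 1)`, with exponent parameter `-α`.
  set h : ℝ → ℝ := (Ioo 0 2).indicator 1 with hh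
  -- the part over `(0, 1)`
  have hA : EqOn (fun u => (u ^ α - h u) / (u - 1)) (fun v => -((v ^ (α + 1 - 1) - 1) / (1 - v)))
      (Ioo 0 1) := fun v hv => by
    have : v ∈ Ioo (0 : ℝ) 2 := ⟨hv.1, by linarith [hv.2]⟩
    have h1 : 1 - v ≠ 0 := by linarith [hv.2]
    have h2 : v - 1 ≠ 0 := by intro h; apply h1; linarith
    simp only [hh, indicator_of_mem this, Pi.one_apply, add_sub_cancel_right]
    rw [← div_neg, neg_sub]
  have hAint : IntegrableOn (fun u => (u ^ α - h u) / (u - 1)) (Ioo 0 1) :=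
    (integrableOn_rpow_sub_one_div (b := α + 1) (by linarith) (by linarith)).neg.congr_fun
      hA.symm measurableSet_Ioo
  have hAval : ∫ u in Ioo 0 1, (u ^ α - h u) / (u - 1)
      = -∫ v in Ioo (0 : ℝ) 1, (v ^ (α + 1 - 1) - 1) / (1 - v) := by
    rw [setIntegral_congr_fun measurableSet_Ioo hA, integral_neg]
  -- the part over `(1, ∞)`, without the comparison function
  have hB : EqOn (fun v : ℝ => (v ^ 2)⁻¹ * ((v⁻¹ ^ α - v⁻¹⁻¹) / (v⁻¹ - 1)))
      (fun v => (v ^ (-α - 1) - 1) / (1 - v)) (Ioo 0 1) := fun v hv => by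
    have hv0 := hv.1.ne'
    have h1 : 1 - v ≠ 0 := by linarith [hv.2]
    beta_reduce
    rw [inv_rpow hv.1.le, ← rpow_neg hv.1.le, rpow_sub_one hv0, inv_inv,
      show v⁻¹ - 1 = (1 - v) / v by field_simp]
    field_simp
  have hBint : IntegrableOn (fun u : ℝ => (u ^ α - u⁻¹) / (u - 1)) (Ioi 1) :=
    (inv_change_of_variables _).1.2 ((integrableOn_rpow_sub_one_div (b := -α) (by linarith)
      (by linarith)).congr_fun hB.symm measurableSet_Ioo)
  have hBval : ∫ u in Ioi 1, ((u ^ α - u⁻¹) / (u - 1))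
      = ∫ v in Ioo (0 : ℝ) 1, (v ^ (-α - 1) - 1) / (1 - v) := by
    rw [(inv_change_of_variables _).2, setIntegral_congr_fun measurableSet_Ioo hB]
  -- the comparison function over `(1, ∞)`
  have hC1 : EqOn (fun u : ℝ => (u⁻¹ - h u) / (u - 1)) (fun u => -u⁻¹) (Ioo 1 2) := fun u hu => by
    have : u ∈ Ioo (0 : ℝ) 2 := ⟨by linarith [hu.1], hu.2⟩
    have h1 : u - 1 ≠ 0 := by linarith [hu.1]
    have h0 : u ≠ 0 := by linarith [hu.1]
    simp only [hh, indicator_of_mem this, Pi.one_apply]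
    field_simp
    ring
  have hC2 : EqOn (fun u : ℝ => (u⁻¹ - h u) / (u - 1)) (fun u => (u * (u - 1))⁻¹) (Ioi 2) :=
    fun u hu => by
    have : u ∉ Ioo (0 : ℝ) 2 := fun h' => absurd h'.2 (not_lt.2 (le_of_lt hu))
    simp only [hh, indicator_of_notMem this, sub_zero]
    rw [div_eq_mul_inv, mul_inv]
  have hinv : IntegrableOn (fun u : ℝ => -u⁻¹) (Ioo 1 2) := by
    refine IntegrableOn.mono_set (t := Icc 1 2) ?_ Ioo_subset_Icc_self
    refine ContinuousOn.integrableOn_compact isCompact_Icc ?_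
    exact (continuousOn_inv₀.mono fun u hu => by
      simp only [mem_compl_iff, mem_singleton_iff]; linarith [hu.1]).neg
  have hder : ∀ u ∈ Ici (2 : ℝ), HasDerivAt (fun u : ℝ => Real.log (u - 1) - Real.log u)
      ((u * (u - 1))⁻¹) u := fun u hu => by
    have hu' : (2 : ℝ) ≤ u := hu
    have h1 : u - 1 ≠ 0 := by linarith
    have h0 : u ≠ 0 := by linarith
    refine ((((hasDerivAt_id' u).sub_const 1).log h1).sub (Real.hasDerivAt_log h0)).congr_deriv ?_
    field_simp
    ring
  have hlim : Tendsto (fun u : ℝ => Real.log (u - 1) - Real.log u) atTop (𝓝 0) := by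
    have h1 : Tendsto (fun u : ℝ => Real.log (1 - u⁻¹)) atTop (𝓝 (Real.log (1 - 0))) :=
      (tendsto_const_nhds.sub tendsto_inv_atTop_zero).log (by norm_num)
    rw [sub_zero, Real.log_one] at h1
    refine h1.congr' ?_
    filter_upwards [eventually_gt_atTop 1] with u hu
    rw [← Real.log_div (by linarith) (by linarith)]
    congr 1
    field_simp
  have hpos : ∀ u ∈ Ioi (2 : ℝ), 0 ≤ (u * (u - 1))⁻¹ := fun u hu => by
    have hu' : (2 : ℝ) < u := hu
    exact inv_nonneg.2 (mul_nonneg (by linarith) (by linarith))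
  have hD := integral_Ioi_of_hasDerivAt_of_nonneg' hder hpos hlim
  have hDint := integrableOn_Ioi_deriv_of_nonneg' hder hpos hlim
  have hsplit : (Ioo (1 : ℝ) 2 ∪ Ioi 2 : Set ℝ) =ᵐ[volume] Ioi 1 := by
    rw [← Ioc_union_Ioi_eq_Ioi (one_le_two : (1 : ℝ) ≤ 2)]
    exact Ioo_ae_eq_Ioc.union (ae_eq_refl _)
  have hdisj : Disjoint (Ioo (1 : ℝ) 2) (Ioi 2) :=
    Set.disjoint_left.2 fun u h1 h2 => absurd h1.2 (not_lt.2 (le_of_lt h2))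
  have hCint1 := hinv.congr_fun hC1.symm measurableSet_Ioo
  have hCint2 := hDint.congr_fun hC2.symm measurableSet_Ioi
  have hCint : IntegrableOn (fun u : ℝ => (u⁻¹ - h u) / (u - 1)) (Ioi 1) :=
    (hCint1.union hCint2).congr_set_ae hsplit.symm
  -- The contributions `-log 2` from `(1, 2)` and `log 2` from `(2, ∞)` cancel.
  have hCval : ∫ u in Ioi 1, (u⁻¹ - h u) / (u - 1) = 0 := by
    rw [← setIntegral_congr_set hsplit, setIntegral_union hdisj measurableSet_Ioi hCint1 hCint2,
      setIntegral_congr_fun measurableSet_Ioo hC1, setIntegral_congr_fun measurableSet_Ioi hC2,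
      hD, integral_neg, ← integral_Ioc_eq_integral_Ioo,
      ← intervalIntegral.integral_of_le one_le_two, integral_inv_of_pos one_pos two_pos]
    norm_num
  have hE : (fun u : ℝ => (u ^ α - h u) / (u - 1))
      = fun u => (u ^ α - u⁻¹) / (u - 1) + (u⁻¹ - h u) / (u - 1) := by
    ext u; rw [← add_div]; ring
  have hEint : IntegrableOn (fun u => (u ^ α - h u) / (u - 1)) (Ioi 1) := by
    rw [hE]; exact hBint.add hCint
  have hEval : ∫ u in Ioi 1, (u ^ α - h u) / (u - 1)
      = ∫ v in Ioo (0 : ℝ) 1, (v ^ (-α - 1) - 1) / (1 - v) := by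
    rw [hE, integral_add hBint hCint, hBval, hCval, add_zero]
  have hsplit' : (Ioo (0 : ℝ) 1 ∪ Ioi 1 : Set ℝ) =ᵐ[volume] Ioi 0 := by
    rw [← Ioc_union_Ioi_eq_Ioi (zero_le_one : (0 : ℝ) ≤ 1)]
    exact Ioo_ae_eq_Ioc.union (ae_eq_refl _)
  have hdisj' : Disjoint (Ioo (0 : ℝ) 1) (Ioi 1) :=
    Set.disjoint_left.2 fun u h1 h2 => absurd h1.2 (not_lt.2 (le_of_lt h2))
  have hint : IntegrableOn (fun u => (u ^ α - h u) / (u - 1)) (Ioi 0) :=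
    (hAint.union hEint).congr_set_ae hsplit'.symm
  have hval : ∫ u in Ioi 0, (u ^ α - h u) / (u - 1) = -(π * Real.cot (π * α)) := by
    rw [← setIntegral_congr_set hsplit', setIntegral_union hdisj' measurableSet_Ioi hAint hEint,
      hAval, hEval]
    have s1 := hasSum_integral_rpow_sub_one_div (b := -α) (by linarith) (by linarith)
    have s2 := hasSum_integral_rpow_sub_one_div (b := α + 1) (by linarith) (by linarith)
    -- The terms `1/(k+1)` of the two series cancel, leaving the cotangent series.
    have s3 := s1.sub s2
    rw [neg_add_eq_sub]
    refine s3.unique ((hasSum_cot hα hα0).congr_fun fun k => ?_)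
    rw [← sub_eq_add_neg]
    ring
  have := hasCauchyPV_indicator_Ioo.add (hasCauchyPV_of_integrableOn hint)
  rw [hval, zero_add] at this
  exact this.congr fun t _ => by simp [hh]

/-! ### The Kummer series: convergence, derivative, contiguity -/

theorem summable_mul_pow_div_factorial {u : ℕ → ℝ} {D : ℝ} (hu : ∀ k, |u k| ≤ D ^ k) (x : ℝ) :
    Summable fun k => u k * x ^ k / k.factorial := by
  refine Summable.of_norm_bounded (Real.summable_pow_div_factorial (D * |x|)) fun k => ?_
  rw [norm_div, norm_mul, norm_pow, Real.norm_natCast, mul_pow]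
  exact div_le_div_of_nonneg_right (mul_le_mul_of_nonneg_right (hu k) (by positivity))
    (by positivity)

/-- Termwise differentiation on the ball of radius `|x| + 1`, where the differentiated terms are
dominated by an exponential series after an index shift. -/
theorem hasDerivAt_tsum_mul_pow_div_factorial {u : ℕ → ℝ} {D : ℝ} (hu : ∀ k, |u k| ≤ D ^ k)
    (x : ℝ) : HasDerivAt (fun y => ∑' k, u k * y ^ k / k.factorial)
      (∑' k, u (k + 1) * x ^ k / k.factorial) x := by
  have hD : 0 ≤ D := by simpa using (abs_nonneg _).trans (hu 1)
  have hterm : ∀ (k : ℕ) (y : ℝ), u (k + 1) * (((k + 1 : ℕ) : ℝ) * y ^ k) / (k + 1).factorial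
      = u (k + 1) * y ^ k / k.factorial := fun k y => by
    rw [Nat.factorial_succ]
    push_cast
    have h1 : (k : ℝ) + 1 ≠ 0 := by positivity
    have h2 : (k.factorial : ℝ) ≠ 0 := by positivity
    field_simp
  have hshift : ∀ k, |u (k + 1)| ≤ D * D ^ k := fun k => by
    simpa [pow_succ, mul_comm] using hu (k + 1)
  set r := |x| + 1 with hr
  have hsum : Summable fun k : ℕ => |u k| * (k * r ^ (k - 1)) / k.factorial := by
    refine (summable_nat_add_iff 1).1 ?_
    refine Summable.of_nonneg_of_le (fun k => by positivity) (fun k => ?_)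
      ((Real.summable_pow_div_factorial (D * r)).mul_left D)
    have hk : |u (k + 1)| * (((k + 1 : ℕ) : ℝ) * r ^ k) / (k + 1).factorial
        = |u (k + 1)| * r ^ k / k.factorial := by
      rw [Nat.factorial_succ]
      push_cast
      have h1 : (k : ℝ) + 1 ≠ 0 := by positivity
      have h2 : (k.factorial : ℝ) ≠ 0 := by positivity
      field_simp
    rw [Nat.add_sub_cancel, hk, mul_pow, ← mul_div_assoc, ← mul_assoc]
    gcongr
    exact hshift k
  have hd := hasDerivAt_tsum_of_isPreconnected (t := Metric.ball (0 : ℝ) r) hsum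
    Metric.isOpen_ball (convex_ball (0 : ℝ) r).isPreconnected
    (g := fun k y => u k * y ^ k / k.factorial)
    (g' := fun k y => u k * (k * y ^ (k - 1)) / k.factorial) (y₀ := 0) (y := x)
    (fun k y _ => ((hasDerivAt_pow k y).const_mul (u k)).div_const _) (fun k y hy => ?_)
    (by simp [hr]; positivity) (summable_mul_pow_div_factorial hu 0) (by simp [hr])
  · refine hd.congr_deriv ?_
    have hs : Summable fun k : ℕ => u k * (k * x ^ (k - 1)) / k.factorial := by
      refine Summable.of_norm_bounded hsum fun k => ?_
      rw [norm_div, norm_mul, norm_mul, norm_pow, Real.norm_natCast, Real.norm_natCast]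
      gcongr
      · exact le_rfl
      · rw [Real.norm_eq_abs, hr]; linarith
    rw [hs.tsum_eq_zero_add]
    simp only [Nat.cast_zero, zero_mul, mul_zero, zero_div, zero_add, Nat.add_sub_cancel]
    exact tsum_congr fun k => hterm k x
  · rw [norm_div, norm_mul, norm_mul, norm_pow, Real.norm_natCast, Real.norm_natCast]
    gcongr
    · exact le_rfl
    · simpa using (mem_ball_zero_iff.1 hy).le

theorem ascPochhammer_eval_succ' (k : ℕ) (a : ℝ) :
    (ascPochhammer ℝ (k + 1)).eval a = a * (ascPochhammer ℝ k).eval (a + 1) := by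
  rw [ascPochhammer_succ_left]
  simp

theorem ascPochhammer_eval_ne_zero {c : ℝ} (hc : ∀ k : ℕ, c + k ≠ 0) (k : ℕ) :
    (ascPochhammer ℝ k).eval c ≠ 0 := by
  induction k with
  | zero => simp
  | succ k ih =>
    rw [ascPochhammer_succ_eval]
    exact mul_ne_zero ih (hc k)

/-- The ratio of consecutive coefficients is `(a+k)/(c+k)`, which tends to `1` and is therefore
bounded. A vanishing denominator is harmless, since the quotient is then zero by convention. -/
theorem exists_abs_ascPochhammer_div_le_pow (a : ℝ) (c : ℝ) :
    ∃ D : ℝ, ∀ k : ℕ, |(ascPochhammer ℝ k).eval a / (ascPochhammer ℝ k).eval c| ≤ D ^ k := by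
  have hlim : Tendsto (fun k : ℕ => |(a + k) / (c + k)|) atTop (𝓝 1) := by
    have h : Tendsto (fun k : ℕ => 1 + (a - c) / (c + k)) atTop (𝓝 (1 + 0)) :=
      tendsto_const_nhds.add (tendsto_const_nhds.div_atTop
        (tendsto_atTop_add_const_left _ _ tendsto_natCast_atTop_atTop))
    rw [add_zero] at h
    rw [← abs_one (α := ℝ)]
    refine (h.congr' ?_).abs
    have h0 : ∀ᶠ k : ℕ in atTop, 0 < c + k :=
      (tendsto_atTop_add_const_left _ c tendsto_natCast_atTop_atTop).eventually_gt_atTop 0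
    filter_upwards [h0] with k hk
    field_simp
    ring
  obtain ⟨D, hD⟩ := hlim.bddAbove_range
  refine ⟨D, fun k => ?_⟩
  have hD' : ∀ k : ℕ, |(a + k) / (c + k)| ≤ D := fun k => hD (mem_range_self k)
  induction k with
  | zero => simp
  | succ k ih =>
    rw [ascPochhammer_succ_eval, ascPochhammer_succ_eval, mul_div_mul_comm, abs_mul, pow_succ]
    exact mul_le_mul ih (hD' k) (abs_nonneg _) ((abs_nonneg _).trans ih)

theorem summable_kummerPhi (a c x : ℝ) : Summable fun k : ℕ =>
    (ascPochhammer ℝ k).eval a / (ascPochhammer ℝ k).eval c * x ^ k / k.factorial := by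
  obtain ⟨D, hD⟩ := exists_abs_ascPochhammer_div_le_pow a c
  exact summable_mul_pow_div_factorial hD x

theorem hasDerivAt_kummerPhi (a c x : ℝ) :
    HasDerivAt (kummerPhi a c) (a / c * kummerPhi (a + 1) (c + 1) x) x := by
  obtain ⟨D, hD⟩ := exists_abs_ascPochhammer_div_le_pow a c
  refine (hasDerivAt_tsum_mul_pow_div_factorial hD x).congr_deriv ?_
  rw [kummerPhi, ← tsum_mul_left]
  refine tsum_congr fun k => ?_
  rw [ascPochhammer_eval_succ', ascPochhammer_eval_succ', mul_div_mul_comm]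
  ring

/-- A contiguity relation for the confluent hypergeometric function. -/
theorem kummerPhi_contiguous {a c : ℝ} (hc : ∀ k : ℕ, c - 1 + k ≠ 0) (x : ℝ) :
    (1 - c) * kummerPhi (a - 1) (c - 1) x
      = (1 - a) * kummerPhi a c x - (c - a) * kummerPhi (a - 1) c x := by
  simp only [kummerPhi]
  rw [← tsum_mul_left, ← tsum_mul_left, ← tsum_mul_left,
    ← ((summable_kummerPhi a c x).mul_left _).tsum_sub ((summable_kummerPhi (a - 1) c x).mul_left _)]
  refine tsum_congr fun k => ?_
  have hc' : ∀ k : ℕ, c + k ≠ 0 := fun k => by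
    have := hc (k + 1)
    push_cast at this
    intro h
    apply this
    linarith
  have h1 := ascPochhammer_eval_ne_zero hc k
  have h2 := ascPochhammer_eval_ne_zero hc' k
  -- Coefficient by coefficient, the relation reduces to these two ways of shifting a rising
  -- factorial by one.
  have e1 : (c - 1) * (ascPochhammer ℝ k).eval c = (ascPochhammer ℝ k).eval (c - 1) * (c - 1 + k) := by
    rw [← ascPochhammer_succ_eval, ascPochhammer_eval_succ', sub_add_cancel]
  have e2 : (a - 1) * (ascPochhammer ℝ k).eval a = (ascPochhammer ℝ k).eval (a - 1) * (a - 1 + k) := by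
    rw [← ascPochhammer_succ_eval, ascPochhammer_eval_succ', sub_add_cancel]
  have h3 : (k.factorial : ℝ) ≠ 0 := by positivity
  field_simp
  linear_combination (-(eval (a - 1) (ascPochhammer ℝ k)) * x ^ k) * e1
    + (eval (c - 1) (ascPochhammer ℝ k)) * x ^ k * e2

/-- The two rising factorials share all factors except the first of one and the last of the other.
-/
theorem ascPochhammer_neg_div {α : ℝ} (hα : ∀ k : ℕ, α ≠ k) (k : ℕ) :
    (ascPochhammer ℝ k).eval (-α) / (ascPochhammer ℝ k).eval (1 - α) = -α / (k - α) := by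
  have h1 := ascPochhammer_eval_ne_zero (c := 1 - α) (fun k h => hα (k + 1) (by push_cast; linarith)) k
  have h2 : (k : ℝ) - α ≠ 0 := sub_ne_zero.2 (hα k).symm
  rw [div_eq_div_iff h1 h2]
  have := ascPochhammer_eval_succ' k (-α)
  rw [ascPochhammer_succ_eval, neg_add_eq_sub, neg_add_eq_sub] at this
  exact this

theorem kummerPhi_neg_one_sub {α : ℝ} (hα : ∀ k : ℕ, α ≠ k) (x : ℝ) :
    kummerPhi (-α) (1 - α) x = ∑' k : ℕ, -α / (k - α) * x ^ k / k.factorial :=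
  tsum_congr fun k => by rw [ascPochhammer_neg_div hα]

/-- The Kummer side of raising `α` by one in the weight: after multiplication by `e^{-x}`, the
exponential term supplies the moment `Γ(α+1)`. -/
theorem kummerPhi_neg_add_one {α : ℝ} (hα : ∀ k : ℕ, α ≠ k) (hα1 : α ≠ -1) (x : ℝ) :
    α * kummerPhi (-(α + 1)) (1 - (α + 1)) x
      = α * exp x + x * kummerPhi (-α) (1 - α) x := by
  have hα1' : ∀ k : ℕ, α + 1 ≠ k := fun k hk => by
    rcases k with _ | k
    · exact hα1 (by push_cast at hk; linarith)
    · exact hα k (by push_cast at hk; linarith)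
  have hs0 := summable_kummerPhi (-α) (1 - α) x
  have hs1 := summable_kummerPhi (-(α + 1)) (1 - (α + 1)) x
  simp only [ascPochhammer_neg_div hα, ascPochhammer_neg_div hα1'] at hs0 hs1
  have hexp := (NormedSpace.expSeries_div_hasSum_exp x).tsum_eq
  have hsexp := Real.summable_pow_div_factorial x
  rw [← Real.exp_eq_exp_ℝ] at hexp
  rw [kummerPhi_neg_one_sub hα, kummerPhi_neg_one_sub hα1', ← hexp, ← tsum_mul_left,
    (hs1.mul_left α).tsum_eq_zero_add, hsexp.tsum_eq_zero_add, mul_add, ← tsum_mul_left,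
    ← tsum_mul_left, add_assoc,
    ← Summable.tsum_add (((summable_nat_add_iff 1).2 hsexp).mul_left _) (hs0.mul_left x)]
  congr 1
  · have : α + 1 ≠ 0 := by simpa using hα1' 0
    have : (0 : ℝ) - (α + 1) ≠ 0 := by rw [zero_sub]; exact neg_ne_zero.2 this
    simp only [Nat.cast_zero, pow_zero, Nat.factorial_zero, Nat.cast_one]
    field_simp
    ring
  · refine tsum_congr fun k => ?_
    have h1 : (k : ℝ) - α ≠ 0 := sub_ne_zero.2 (hα k).symm
    have h2 : (k : ℝ) + 1 - (α + 1) ≠ 0 := by rwa [add_sub_add_right_eq_sub]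
    rw [Nat.factorial_succ]
    push_cast
    have h3 : (k : ℝ) + 1 ≠ 0 := by positivity
    have h4 : (k.factorial : ℝ) ≠ 0 := by positivity
    rw [add_sub_add_right_eq_sub]
    field_simp
    ring

/-! ### Principal value of the Laguerre weight -/

theorem integrableOn_rpow_mul_exp_neg_mul {s b : ℝ} (hs : -1 < s) (hb : 0 < b) :
    IntegrableOn (fun t : ℝ => t ^ s * exp (-(b * t))) (Ioi 0) := by
  simpa using integrableOn_rpow_mul_exp_neg_mul_rpow hs one_pos hb

theorem integral_rpow_mul_exp_neg_mul {s b : ℝ} (hs : -1 < s) (hb : 0 < b) :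
    ∫ t in Ioi (0 : ℝ), t ^ s * exp (-(b * t)) = b ^ (-s - 1) * Real.Gamma (s + 1) := by
  have h := Real.integral_rpow_mul_exp_neg_mul_Ioi (a := s + 1) (by linarith) hb
  rw [add_sub_cancel_right] at h
  rw [h, one_div, inv_rpow hb.le, ← rpow_neg hb.le, neg_add, ← sub_eq_add_neg]

theorem integrableOn_exp_mul_rpow {s : ℝ} (hs : -1 < s) (x : ℝ) :
    IntegrableOn (fun t : ℝ => exp t * t ^ s) (Ioc 0 x) := by
  rcases le_total 0 x with hx | hx
  · refine (intervalIntegrable_iff_integrableOn_Ioc_of_le hx).1 ?_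
    exact (intervalIntegral.intervalIntegrable_rpow' hs).continuousOn_mul
      (Real.continuous_exp.continuousOn)
  · simp [Ioc_eq_empty_of_le hx]

theorem integral_exp_mul_rpow {α x : ℝ} (hα0 : α < 0) (hx : 0 < x) :
    ∫ s in Ioc 0 x, exp s * s ^ (-α - 1)
      = x ^ (-α) * ∑' k : ℕ, 1 / (k - α) * x ^ k / k.factorial := by
  set F : ℕ → ℝ → ℝ := fun k s => s ^ ((k : ℝ) - α - 1) / k.factorial with hF
  have hexpo : ∀ k : ℕ, -1 < (k : ℝ) - α - 1 := fun k => by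
    have : (0 : ℝ) ≤ k := k.cast_nonneg
    linarith
  have hint : ∀ k, Integrable (F k) (volume.restrict (Ioc 0 x)) := fun k =>
    ((intervalIntegrable_iff_integrableOn_Ioc_of_le hx.le).1
      (intervalIntegral.intervalIntegrable_rpow' (hexpo k))).div_const _
  have hval : ∀ k, ∫ s in Ioc 0 x, F k s = x ^ (-α) * (1 / (k - α) * x ^ k / k.factorial) := by
    intro k
    have h1 : (k : ℝ) - α ≠ 0 := by have := hexpo k; intro h; linarith
    rw [hF, integral_div, ← intervalIntegral.integral_of_le hx.le, integral_rpow (Or.inl (hexpo k)),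
      sub_add_cancel, zero_rpow h1, sub_zero, sub_eq_neg_add, rpow_add hx, rpow_natCast]
    ring
  have hnorm : ∀ k, ∫ s in Ioc 0 x, ‖F k s‖ = x ^ (-α) * (1 / (k - α) * x ^ k / k.factorial) := by
    intro k
    rw [← hval k]
    refine setIntegral_congr_fun measurableSet_Ioc fun v hv => ?_
    exact Real.norm_of_nonneg (div_nonneg (rpow_nonneg hv.1.le _) (by positivity))
  have hsum : Summable fun k : ℕ => 1 / ((k : ℝ) - α) * x ^ k / k.factorial := by
    have := (summable_kummerPhi (-α) (1 - α) x).mul_left (-α)⁻¹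
    refine this.congr fun k => ?_
    rw [ascPochhammer_neg_div fun m h => ?_]
    · have h0 : -α ≠ 0 := by linarith
      rw [div_eq_mul_one_div (-α), mul_assoc (-α), mul_div_assoc, ← mul_assoc,
        inv_mul_cancel₀ h0, one_mul]
    · have : (0 : ℝ) ≤ m := m.cast_nonneg
      linarith
  have key := hasSum_integral_of_summable_integral_norm hint
    (by simpa only [hnorm] using hsum.mul_left _)
  simp only [hval] at key
  rw [← tsum_mul_left, key.tsum_eq]
  refine setIntegral_congr_fun measurableSet_Ioc fun s hs => ?_
  have hexp := (NormedSpace.expSeries_div_hasSum_exp s).tsum_eq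
  rw [← Real.exp_eq_exp_ℝ] at hexp
  rw [← hexp, ← tsum_mul_right]
  refine tsum_congr fun k => ?_
  rw [hF]
  beta_reduce
  rw [show (k : ℝ) - α - 1 = k + (-α - 1) by ring, rpow_add hs.1, rpow_natCast]
  ring

theorem integral_Ioc_exp_mul {x c : ℝ} (hx : 0 < x) (hc : c ≠ 0) :
    ∫ s in Ioc 0 x, exp (-(s * c)) = -((exp (-(x * c)) - 1) / c) := by
  rw [← intervalIntegral.integral_of_le hx.le]
  have hd : ∀ s ∈ uIcc 0 x, HasDerivAt (fun s : ℝ => -(exp (-(s * c)) / c)) (exp (-(s * c))) s :=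
    fun s _ => by
      refine ((((hasDerivAt_id' s).mul_const c).neg.exp.div_const c).neg).congr_deriv ?_
      simp only [Pi.neg_apply]
      field_simp
  rw [intervalIntegral.integral_eq_sub_of_hasDerivAt hd]
  · simp only [zero_mul, neg_zero, exp_zero]
    ring
  · exact (by fun_prop : Continuous fun s : ℝ => exp (-(s * c))).intervalIntegrable _ _

/-- Write `(1 - e^{-x(u-1)})/(u-1)` as `∫_0^x e^{-s(u-1)} ds` and apply Fubini. The inner integral
over `u` is a Gamma integral, and `α < 0` makes `s^(-α-1)` integrable at `0`. -/
theorem integral_rpow_mul_exp_sub_one {α x : ℝ} (hα : -1 < α) (hα0 : α < 0) (hx : 0 < x) :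
    IntegrableOn (fun u : ℝ => u ^ α * (exp (-(x * (u - 1))) - 1) / (u - 1)) (Ioi 0) ∧
      ∫ u in Ioi 0, u ^ α * (exp (-(x * (u - 1))) - 1) / (u - 1)
        = -(Real.Gamma (α + 1) * ∫ s in Ioc 0 x, exp s * s ^ (-α - 1)) := by
  set G : ℝ → ℝ → ℝ := fun u s => u ^ α * exp (-(s * (u - 1))) with hG
  have hGs : ∀ s u, G u s = exp s * (u ^ α * exp (-(s * u))) := fun s u => by
    rw [hG]
    beta_reduce
    rw [show -(s * (u - 1)) = s + -(s * u) by ring, exp_add]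
    ring
  have hmeas : Measurable (Function.uncurry G) := by
    simp only [hG, Function.uncurry_def]
    fun_prop
  have hs : ∀ s ∈ Ioc 0 x, ∫ u in Ioi 0, G u s = Real.Gamma (α + 1) * (exp s * s ^ (-α - 1)) :=
    fun s hs => by
      simp only [hGs]
      rw [integral_const_mul, integral_rpow_mul_exp_neg_mul hα hs.1]
      ring
  have hsn : ∀ s ∈ Ioc 0 x, ∫ u in Ioi 0, ‖Function.uncurry G (u, s)‖
      = Real.Gamma (α + 1) * (exp s * s ^ (-α - 1)) := fun s hs' => by
    rw [← hs s hs']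
    refine setIntegral_congr_fun measurableSet_Ioi fun u hu => ?_
    exact Real.norm_of_nonneg (mul_nonneg (rpow_nonneg (le_of_lt hu) _) (exp_pos _).le)
  have hint : Integrable (Function.uncurry G)
      ((volume.restrict (Ioi 0)).prod (volume.restrict (Ioc 0 x))) := by
    refine (integrable_prod_iff' hmeas.aestronglyMeasurable).2 ⟨?_, ?_⟩
    · refine (ae_restrict_iff' measurableSet_Ioc).2 (Eventually.of_forall fun s hs => ?_)
      simp only [Function.uncurry_apply_pair, hGs]
      exact (integrableOn_rpow_mul_exp_neg_mul hα hs.1).const_mul _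
    · exact IntegrableOn.congr_fun ((integrableOn_exp_mul_rpow (by linarith) x).const_mul
        (Real.Gamma (α + 1))) (fun s hs' => (hsn s hs').symm) measurableSet_Ioc
  have hae : (fun u => ∫ s in Ioc 0 x, G u s) =ᵐ[volume.restrict (Ioi 0)]
      fun u : ℝ => -(u ^ α * (exp (-(x * (u - 1))) - 1) / (u - 1)) := by
    have : ∀ᵐ t ∂(volume.restrict (Ioi (0 : ℝ))), t ≠ 1 := ae_restrict_of_ae (Measure.ae_ne volume 1)
    filter_upwards [this] with u hu
    simp only [hG]
    rw [integral_const_mul, integral_Ioc_exp_mul hx (sub_ne_zero.2 hu)]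
    ring
  constructor
  · have := (hint.integral_prod_left.congr hae).neg
    simp only [Pi.neg_def, neg_neg] at this
    exact this
  · have h1 := integral_integral_swap hint
    rw [integral_congr_ae hae, integral_neg, setIntegral_congr_fun measurableSet_Ioc hs,
      integral_const_mul] at h1
    linarith

/-- The Cauchy principal value of the Laguerre weight. -/
noncomputable def weightPV (α x : ℝ) : ℝ :=
  Real.Gamma α * exp (-x) * kummerPhi (-α) (1 - α) x
    - π * Real.cot (π * α) * x ^ α * exp (-x)

/-- With `t = x u`, the pure power gives the cotangent term and the remainder `e^{-x(u-1)} - 1`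
gives the Kummer term. -/
theorem hasCauchyPV_laguerreWeight_of_neg {α x : ℝ} (hα : -1 < α) (hα0 : α < 0) (hx : 0 < x) :
    HasCauchyPV (laguerreWeight α) x (weightPV α x) := by
  obtain ⟨h1, h2⟩ := integral_rpow_mul_exp_sub_one hα hα0 hx
  have h3 := (((hasCauchyPV_rpow_one hα hα0).add (hasCauchyPV_of_integrableOn h1)).comp_div
    hx).const_mul (x ^ α * exp (-x))
  rw [h2, integral_exp_mul_rpow hα0 hx, Real.Gamma_add_one hα0.ne] at h3
  have hnat : ∀ k : ℕ, α ≠ k := fun k h => by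
    have : (0 : ℝ) ≤ k := k.cast_nonneg
    linarith
  have hk : kummerPhi (-α) (1 - α) x = -α * ∑' k : ℕ, 1 / (k - α) * x ^ k / k.factorial := by
    rw [kummerPhi_neg_one_sub hnat, ← tsum_mul_left]
    exact tsum_congr fun k => by ring
  have hv : x ^ α * exp (-x) * (-(π * Real.cot (π * α)) + -(α * Real.Gamma α *
      (x ^ (-α) * ∑' k : ℕ, 1 / (k - α) * x ^ k / k.factorial))) = weightPV α x := by
    have hxx : x ^ α * x ^ (-α) = 1 := by rw [← rpow_add hx]; simp
    rw [weightPV, hk]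
    linear_combination (-(α * Real.Gamma α * exp (-x)
      * ∑' k : ℕ, 1 / (k - α) * x ^ k / k.factorial)) * hxx
  rw [hv] at h3
  refine h3.congr fun t ht => ?_
  have e1 : -(x * (t / x - 1)) = x - t := by field_simp; ring
  have e2 : x ^ α ≠ 0 := (rpow_pos_of_pos hx _).ne'
  rw [e1, div_rpow ht.le hx.le, laguerreWeight]
  have e3 : exp (-x) * exp (x - t) = exp (-t) := by rw [← exp_add]; ring_nf
  rw [← e3]
  field_simp
  ring

theorem integrableOn_laguerreWeight {α : ℝ} (hα : -1 < α) :
    IntegrableOn (laguerreWeight α) (Ioi 0) := by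
  have := integrableOn_rpow_mul_exp_neg_mul hα one_pos
  simp only [one_mul] at this
  exact this

theorem integral_laguerreWeight {α : ℝ} (hα : -1 < α) :
    ∫ t in Ioi 0, laguerreWeight α t = Real.Gamma (α + 1) := by
  have := integral_rpow_mul_exp_neg_mul hα one_pos
  simp only [one_mul, one_rpow] at this
  exact this

theorem laguerreWeight_add_one {α t : ℝ} (ht : 0 < t) :
    laguerreWeight (α + 1) t = t * laguerreWeight α t := by
  rw [laguerreWeight, laguerreWeight, rpow_add_one ht.ne']
  ring

theorem cot_pi_mul_add_one (α : ℝ) : Real.cot (π * (α + 1)) = Real.cot (π * α) := by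
  rw [Real.cot_eq_cos_div_sin, Real.cot_eq_cos_div_sin, mul_add, mul_one, Real.cos_add_pi,
    Real.sin_add_pi, neg_div_neg_eq]

theorem weightPV_add_one {α x : ℝ} (hα : ∀ k : ℕ, α ≠ k) (hα1 : α ≠ -1) (hx : 0 < x) :
    weightPV (α + 1) x = x * weightPV α x + Real.Gamma (α + 1) := by
  have h0 : α ≠ 0 := by simpa using hα 0
  have h := kummerPhi_neg_add_one hα hα1 x
  have he : exp (-x) * exp x = 1 := by rw [← exp_add]; simp
  rw [weightPV, weightPV, cot_pi_mul_add_one, Real.Gamma_add_one h0, rpow_add_one hx.ne']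
  linear_combination Real.Gamma α * exp (-x) * h + α * Real.Gamma α * he

/-- Descend from `α` to `α - 1` until the exponent is negative; non-integrality prevents landing on
`0`. -/
theorem hasCauchyPV_laguerreWeight {α : ℝ} (hα : -1 < α) (hα' : ∀ k : ℕ, α ≠ k) {x : ℝ}
    (hx : 0 < x) : HasCauchyPV (laguerreWeight α) x (weightPV α x) := by
  obtain ⟨m, hm⟩ := exists_nat_gt α
  induction m generalizing α with
  | zero => exact hasCauchyPV_laguerreWeight_of_neg hα (by simpa using hm) hx
  | succ m ih =>
    rcases lt_or_ge α 0 with h0 | h0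
    · exact hasCauchyPV_laguerreWeight_of_neg hα h0 hx
    have hpos : 0 < α := lt_of_le_of_ne h0 (by simpa using (hα' 0).symm)
    have hn : ∀ k : ℕ, α - 1 ≠ k := fun k h => hα' (k + 1) (by push_cast; linarith)
    have h1 := ih (α := α - 1) (by linarith) hn (by push_cast at hm; linarith)
    have h2 := h1.id_mul (integrableOn_laguerreWeight (by linarith))
    rw [integral_laguerreWeight (by linarith), ← weightPV_add_one hn (by linarith) hx,
      sub_add_cancel] at h2
    refine h2.congr fun t ht => ?_
    rw [← laguerreWeight_add_one ht, sub_add_cancel]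

/-! ### Identities between Laguerre polynomials -/

/-- The binomial `n.choose k` vanishes for `k > n`, so this form holds for every `k` and later
identities need no range distinctions. -/
theorem coeff_laguerreL (n : ℕ) (α : ℝ) (k : ℕ) :
    (laguerreL n α).coeff k = (-1) ^ k * (Real.Gamma (n + α + 1) / n.factorial) * n.choose k
      / Real.Gamma (α + k + 1) := by
  rw [laguerreL, finsetSum_coeff]
  simp only [coeff_C_mul_X_pow, Finset.sum_ite_eq, Finset.mem_range]
  split_ifs with h
  · have hk : k ≤ n := Nat.lt_succ_iff.1 h
    have hc : ((n.choose k : ℕ) : ℝ) * k.factorial * (n - k).factorial = n.factorial := by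
      exact_mod_cast Nat.choose_mul_factorial_mul_factorial hk
    have h1 : (k.factorial : ℝ) ≠ 0 := by positivity
    have h2 : ((n - k).factorial : ℝ) ≠ 0 := by positivity
    have h3 : ((n.choose k : ℕ) : ℝ) ≠ 0 := by exact_mod_cast (Nat.choose_pos hk).ne'
    rw [← hc]
    field_simp
  · rw [Nat.choose_eq_zero_of_lt (by omega)]
    simp

theorem natDegree_laguerreL_le (n : ℕ) (α : ℝ) : (laguerreL n α).natDegree ≤ n := by
  refine natDegree_le_iff_coeff_eq_zero.2 fun k hk => ?_
  rw [coeff_laguerreL, Nat.choose_eq_zero_of_lt hk]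
  simp

theorem coeff_laguerreL_self_ne_zero (n : ℕ) {α : ℝ} (hα : -1 < α) :
    (laguerreL n α).coeff n ≠ 0 := by
  have h1 : 0 < Real.Gamma (n + α + 1) :=
    Real.Gamma_pos_of_pos (by have : (0 : ℝ) ≤ n := n.cast_nonneg; linarith)
  have h2 : 0 < Real.Gamma (α + n + 1) :=
    Real.Gamma_pos_of_pos (by have : (0 : ℝ) ≤ n := n.cast_nonneg; linarith)
  rw [coeff_laguerreL, Nat.choose_self]
  positivity

theorem laguerreL_zero {α : ℝ} (hα : -1 < α) : laguerreL 0 α = 1 := by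
  have h : Real.Gamma (α + 1) ≠ 0 := (Real.Gamma_pos_of_pos (by linarith)).ne'
  simp [laguerreL, div_self h]

theorem coeff_X_mul_derivative (P : ℝ[X]) (k : ℕ) :
    (X * derivative P).coeff k = k * P.coeff k := by
  cases k with
  | zero => simp
  | succ k => rw [coeff_X_mul, coeff_derivative]; push_cast; ring

theorem choose_succ_mul_sub (m k : ℕ) :
    ((m + 1).choose k : ℝ) * (m + 1 - k) = (m + 1) * m.choose k := by
  cases k with
  | zero => simp
  | succ k =>
    have h1 : ((m + 1 : ℕ) : ℝ) * m.choose k = (m + 1).choose (k + 1) * ((k + 1 : ℕ) : ℝ) := by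
      exact_mod_cast Nat.add_one_mul_choose_eq m k
    have h2 : ((m + 1).choose (k + 1) : ℝ) = m.choose k + m.choose (k + 1) := by
      exact_mod_cast Nat.choose_succ_succ m k
    push_cast at h1 ⊢
    linear_combination (m + 1 : ℝ) * h2 + h1

theorem Gamma_natCast_succ_add (m : ℕ) {α : ℝ} (hα : -1 < α) :
    Real.Gamma ((m + 1 : ℕ) + α + 1) = (m + α + 1) * Real.Gamma (m + α + 1) := by
  have : (0 : ℝ) ≤ m := m.cast_nonneg
  rw [← Real.Gamma_add_one (by linarith : (m : ℝ) + α + 1 ≠ 0)]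
  push_cast
  ring_nf

/-- At a zero of `L_{m+1}` this ties the derivative to `L_m`, which explains the form of the weights
`γ` and of the derivative of `Q` at nodes. -/
theorem X_mul_derivative_laguerreL (m : ℕ) {α : ℝ} (hα : -1 < α) :
    X * derivative (laguerreL (m + 1) α)
      = C ((m : ℝ) + 1) * laguerreL (m + 1) α - C ((m : ℝ) + 1 + α) * laguerreL m α := by
  ext k
  rw [coeff_X_mul_derivative, coeff_sub, coeff_C_mul, coeff_C_mul, coeff_laguerreL,
    coeff_laguerreL, Gamma_natCast_succ_add m hα, Nat.factorial_succ]
  have h := choose_succ_mul_sub m k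
  have h0 : (0 : ℝ) ≤ k := k.cast_nonneg
  have h1 : Real.Gamma (α + k + 1) ≠ 0 := (Real.Gamma_pos_of_pos (by linarith)).ne'
  have h2 : (m.factorial : ℝ) ≠ 0 := by positivity
  have h3 : (m : ℝ) + 1 ≠ 0 := by positivity
  push_cast
  field_simp
  linear_combination (-((m + α + 1) * Real.Gamma (m + α + 1) : ℝ)) * h

theorem X_mul_laguerreL_add_one (n : ℕ) {α : ℝ} (hα : -1 < α) :
    X * laguerreL n (α + 1)
      = C ((n : ℝ) + α + 1) * laguerreL n α - C ((n : ℝ) + 1) * laguerreL (n + 1) α := by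
  have hΓ : Real.Gamma (n + (α + 1) + 1) = (n + α + 1) * Real.Gamma (n + α + 1) := by
    rw [← Gamma_natCast_succ_add n hα]
    push_cast
    ring_nf
  have h2 : (n.factorial : ℝ) ≠ 0 := by positivity
  have h3 : (n : ℝ) + 1 ≠ 0 := by positivity
  ext k
  rw [coeff_sub, coeff_C_mul, coeff_C_mul, coeff_laguerreL, coeff_laguerreL,
    Gamma_natCast_succ_add n hα, Nat.factorial_succ]
  have h0 : (0 : ℝ) ≤ k := k.cast_nonneg
  have h1 : Real.Gamma (α + k + 1) ≠ 0 := (Real.Gamma_pos_of_pos (by linarith)).ne'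
  push_cast
  cases k with
  | zero =>
    simp only [coeff_X_mul_zero, Nat.choose_zero_right]
    field_simp
    ring
  | succ k =>
    have h4 : ((n + 1).choose (k + 1) : ℝ) = n.choose k + n.choose (k + 1) := by
      exact_mod_cast Nat.choose_succ_succ n k
    have h5 : α + 1 + (k : ℝ) + 1 = α + ((k + 1 : ℕ) : ℝ) + 1 := by push_cast; ring
    rw [coeff_X_mul, coeff_laguerreL, h5, hΓ, h4]
    field_simp
    ring

/-- The Rodrigues-type derivative formula below, with its factor `t^α e^{-t}` divided out. -/
theorem laguerreL_succ (n : ℕ) {α : ℝ} (hα : -1 < α) :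
    C ((n : ℝ) + 1) * laguerreL (n + 1) α
      = C (α + 1) * laguerreL n (α + 1) - X * laguerreL n (α + 1)
        + X * derivative (laguerreL n (α + 1)) := by
  have hΓ : Real.Gamma (n + (α + 1) + 1) = (n + α + 1) * Real.Gamma (n + α + 1) := by
    rw [← Gamma_natCast_succ_add n hα]
    push_cast
    ring_nf
  have h2 : (n.factorial : ℝ) ≠ 0 := by positivity
  have h3 : (n : ℝ) + 1 ≠ 0 := by positivity
  ext k
  rw [coeff_add, coeff_sub, coeff_C_mul, coeff_C_mul, coeff_X_mul_derivative, coeff_laguerreL,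
    coeff_laguerreL, Gamma_natCast_succ_add n hα, hΓ, Nat.factorial_succ]
  have h0 : (0 : ℝ) ≤ k := k.cast_nonneg
  have h6 : α + k + 1 ≠ 0 := by linarith
  have h1 : Real.Gamma (α + k + 1) ≠ 0 := (Real.Gamma_pos_of_pos (by linarith)).ne'
  have h7 : Real.Gamma (α + 1 + k + 1) = (α + k + 1) * Real.Gamma (α + k + 1) := by
    rw [← Real.Gamma_add_one h6]
    ring_nf
  push_cast
  rw [h7]
  cases k with
  | zero =>
    simp only [coeff_X_mul_zero, Nat.choose_zero_right]
    field_simp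
    push_cast
    ring
  | succ k =>
    have h4 : ((n + 1).choose (k + 1) : ℝ) = n.choose k + n.choose (k + 1) := by
      exact_mod_cast Nat.choose_succ_succ n k
    have h5 : α + 1 + (k : ℝ) + 1 = α + ((k + 1 : ℕ) : ℝ) + 1 := by push_cast; ring
    rw [coeff_X_mul, coeff_laguerreL, h5, hΓ, h4]
    field_simp
    push_cast
    ring

/-! ### Zeros of the Laguerre polynomials -/

theorem hasDerivAt_laguerreWeight_mul (n : ℕ) {α : ℝ} (hα : -1 < α) {t : ℝ} (ht : 0 < t) :
    HasDerivAt (fun t => t ^ (α + 1) * exp (-t) * (laguerreL n (α + 1)).eval t)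
      (t ^ α * exp (-t) * ((n + 1) * (laguerreL (n + 1) α).eval t)) t := by
  have h := congrArg (eval t) (laguerreL_succ n hα)
  simp only [eval_add, eval_sub, eval_mul, eval_C, eval_X] at h
  refine (((hasDerivAt_rpow_const (p := α + 1) (Or.inl ht.ne')).mul (hasDerivAt_neg t).exp).mul
    ((laguerreL n (α + 1)).hasDerivAt t)).congr_deriv ?_
  simp only [Pi.mul_apply]
  rw [h, add_sub_cancel_right, rpow_add_one ht.ne']
  ring

/-- Rolle's theorem on a half-line for a function vanishing at infinity. -/
theorem exists_hasDerivAt_eq_zero_of_tendsto {F F' : ℝ → ℝ} {a : ℝ} (hc : ContinuousOn F (Ici a))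
    (hd : ∀ t > a, HasDerivAt F (F' t) t) (ha : F a = 0) (hlim : Tendsto F atTop (𝓝 0)) :
    ∃ y > a, F' y = 0 := by
  have rolle : ∀ p q, a ≤ p → p < q → F p = F q → ∃ y > a, F' y = 0 := fun p q hap hpq h => by
    obtain ⟨y, hy, hy'⟩ := exists_hasDerivAt_eq_zero hpq
      (hc.mono fun t ht => hap.trans ht.1) h fun t ht => hd t (hap.trans_lt ht.1)
    exact ⟨y, hap.trans_lt hy.1, hy'⟩
  by_cases h0 : F (a + 1) = 0
  · exact rolle a (a + 1) le_rfl (by linarith) (by rw [ha, h0])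
  have hpos : 0 < |F (a + 1)| / 2 := by positivity
  obtain ⟨d, hd1, hd2⟩ := ((hlim.abs.eventually (gt_mem_nhds (by rwa [abs_zero] : |(0 : ℝ)| < |F (a + 1)| / 2))).and
    (eventually_gt_atTop (a + 1))).exists
  -- This value is attained on both sides of `a + 1`, since `F` is zero at `a` and tends to zero at
  -- infinity; Rolle's theorem applies between the two points.
  set v := F (a + 1) / 2 with hv
  have hvne : F (a + 1) ≠ v := by intro h; apply h0; linarith
  have h1 : v ∈ uIcc (F a) (F (a + 1)) := by
    rw [ha, mem_uIcc]
    rcases lt_or_gt_of_ne h0 with h | h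
    · right; constructor <;> linarith
    · left; constructor <;> linarith
  have h2 : v ∈ uIcc (F (a + 1)) (F d) := by
    rw [mem_uIcc]
    rcases lt_or_gt_of_ne h0 with h | h
    · rw [abs_of_neg h, abs_lt] at hd1
      left; constructor <;> linarith [hd1.1]
    · rw [abs_of_pos h, abs_lt] at hd1
      right; constructor <;> linarith [hd1.2]
  obtain ⟨p, hp, hp'⟩ := intermediate_value_uIcc (hc.mono fun t ht => by
    rw [uIcc_of_le (by linarith)] at ht; exact ht.1) h1
  obtain ⟨q, hq, hq'⟩ := intermediate_value_uIcc (hc.mono fun t ht => by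
    rw [uIcc_of_le hd2.le] at ht; exact le_trans (by linarith) ht.1) h2
  rw [uIcc_of_le (by linarith)] at hp
  rw [uIcc_of_le hd2.le] at hq
  have hp1 : p < a + 1 := lt_of_le_of_ne hp.2 fun h => hvne (by rw [← h, hp'])
  have hq1 : a + 1 ≤ q := hq.1
  exact rolle p q hp.1 (by linarith) (by rw [hp', hq'])

theorem tendsto_rpow_mul_exp_neg_mul_eval (s : ℝ) (P : ℝ[X]) :
    Tendsto (fun t => t ^ s * exp (-t) * P.eval t) atTop (𝓝 0) := by
  obtain ⟨m, hm⟩ := exists_nat_ge s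
  have h := (X ^ m * P).tendsto_div_exp_atTop.norm
  rw [norm_zero] at h
  refine squeeze_zero_norm' ?_ h
  filter_upwards [eventually_ge_atTop 1] with t ht
  have ht0 : 0 < t := by linarith
  rw [eval_mul, eval_pow, eval_X, exp_neg, norm_mul, norm_mul, norm_div, norm_mul, norm_inv,
    norm_pow, div_eq_mul_inv, mul_right_comm, Real.norm_of_nonneg (rpow_nonneg ht0.le s),
    Real.norm_of_nonneg ht0.le]
  gcongr
  rw [← rpow_natCast]
  exact rpow_le_rpow_of_exponent_le ht hm

/-- The function `t^(α+1) e^{-t} L_n^{α+1}` vanishes at `0`, at the `n` zeros given by induction,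
and at infinity. Rolle's theorem gives `n + 1` interlacing zeros of its derivative, which is a
positive multiple of `L_{n+1}^α`. -/
theorem exists_zeros_laguerreL (n : ℕ) {α : ℝ} (hα : -1 < α) :
    ∃ x : Fin n → ℝ, StrictMono x ∧ (∀ m, 0 < x m) ∧ ∀ m, (laguerreL n α).eval (x m) = 0 := by
  induction n generalizing α with
  | zero => exact ⟨Fin.elim0, fun i => i.elim0, fun i => i.elim0, fun i => i.elim0⟩
  | succ n ih =>
    obtain ⟨z, hz, hz0, hzL⟩ := ih (α := α + 1) (by linarith)
    set F : ℝ → ℝ := fun t => t ^ (α + 1) * exp (-t) * (laguerreL n (α + 1)).eval t with hF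
    set a : Fin (n + 1) → ℝ := Fin.cons 0 z with ha
    have haF : ∀ i, F (a i) = 0 := fun i => by
      refine Fin.cases ?_ (fun j => ?_) i
      · simp [hF, ha, zero_rpow (by linarith : α + 1 ≠ 0)]
      · simp [hF, ha, hzL]
    have ha0 : ∀ i, 0 ≤ a i := fun i => by
      refine Fin.cases ?_ (fun j => ?_) i
      · simp [ha]
      · simpa [ha] using (hz0 j).le
    have hamono : StrictMono a := by
      intro i j
      refine Fin.cases ?_ (fun i => ?_) i
      · refine Fin.cases (fun h => absurd h (lt_irrefl _)) (fun j _ => ?_) j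
        simpa [ha] using hz0 j
      · refine Fin.cases (fun h => absurd h (Fin.not_lt_zero _)) (fun j h => ?_) j
        simpa [ha] using hz (Fin.succ_lt_succ_iff.1 h)
    have hcont : ContinuousOn F (Ici 0) := by
      refine ((ContinuousOn.rpow_const continuousOn_id fun t _ => Or.inr (by linarith)).mul
        (by fun_prop)).mul (laguerreL n (α + 1)).continuousOn
    have hder : ∀ t > 0, HasDerivAt F
        (t ^ α * exp (-t) * ((n + 1) * (laguerreL (n + 1) α).eval t)) t :=
      fun t ht => hasDerivAt_laguerreWeight_mul n hα ht
    have hzero : ∀ t > 0, t ^ α * exp (-t) * ((n + 1) * (laguerreL (n + 1) α).eval t) = 0 →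
        (laguerreL (n + 1) α).eval t = 0 := fun t ht h => by
      have h1 : t ^ α ≠ 0 := (rpow_pos_of_pos ht _).ne'
      have h2 : (n : ℝ) + 1 ≠ 0 := by positivity
      simpa [h1, h2] using h
    have key : ∀ i : Fin (n + 1), ∃ y, a i < y ∧ (∀ j : Fin n, i = j.castSucc → y < a j.succ) ∧
        (laguerreL (n + 1) α).eval y = 0 := fun i => by
      refine Fin.lastCases ?_ (fun j => ?_) i
      · obtain ⟨y, hy, hy'⟩ := exists_hasDerivAt_eq_zero_of_tendsto
          (hcont.mono (Ici_subset_Ici.2 (ha0 (Fin.last n))))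
          (fun t ht => hder t ((ha0 _).trans_lt ht)) (haF (Fin.last n))
          (tendsto_rpow_mul_exp_neg_mul_eval _ _)
        refine ⟨y, hy, fun j hj => ?_, hzero y ((ha0 _).trans_lt hy) hy'⟩
        exact absurd hj (Fin.castSucc_lt_last j).ne'
      · obtain ⟨y, hy, hy'⟩ := exists_hasDerivAt_eq_zero (hamono (Fin.castSucc_lt_succ (i := j)))
          (hcont.mono fun t ht => (ha0 _).trans ht.1) ((haF _).trans (haF _).symm)
          fun t ht => hder t ((ha0 _).trans_lt ht.1)
        refine ⟨y, hy.1, fun j' hj' => ?_, hzero y ((ha0 _).trans_lt hy.1) hy'⟩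
        rw [← Fin.castSucc_injective n hj']
        exact hy.2
    choose y hy1 hy2 hy3 using key
    refine ⟨y, Fin.strictMono_iff_lt_succ.2 fun j => ?_, fun m => (ha0 m).trans_lt (hy1 m), hy3⟩
    exact (hy2 _ j rfl).trans (hy1 _)

theorem laguerreL_eq_nodal {n : ℕ} {α : ℝ} {x : Fin n → ℝ} (hx : Function.Injective x)
    (h0 : ∀ m, (laguerreL n α).eval (x m) = 0) :
    laguerreL n α = C ((laguerreL n α).coeff n) * Lagrange.nodal Finset.univ x := by
  have hdeg : (Lagrange.nodal Finset.univ x).natDegree = n := by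
    rw [Lagrange.natDegree_nodal]; simp
  refine eq_of_degree_sub_lt_of_eval_index_eq (Finset.univ : Finset (Fin n)) hx.injOn ?_ ?_
  · rw [Finset.card_univ, Fintype.card_fin, degree_lt_iff_coeff_zero]
    intro m hm
    rw [coeff_sub, coeff_C_mul]
    rcases hm.eq_or_lt with rfl | hlt
    · have : (Lagrange.nodal Finset.univ x).coeff n = 1 := by
        have := (Lagrange.nodal_monic (s := Finset.univ) (v := x)).coeff_natDegree
        rwa [hdeg] at this
      rw [this, mul_one, sub_self]
    · rw [coeff_eq_zero_of_natDegree_lt ((natDegree_laguerreL_le n α).trans_lt hlt),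
        coeff_eq_zero_of_natDegree_lt (p := Lagrange.nodal _ _)
          (by rw [hdeg]; exact hlt), mul_zero, sub_zero]
  · intro m _
    rw [h0, eval_mul, Lagrange.eval_nodal_at_node (Finset.mem_univ m), mul_zero]

theorem eval_laguerreL_eq_zero_iff {n : ℕ} {α : ℝ} (hα : -1 < α) {x : Fin n → ℝ}
    (hx : Function.Injective x) (h0 : ∀ m, (laguerreL n α).eval (x m) = 0) (t : ℝ) :
    (laguerreL n α).eval t = 0 ↔ ∃ m, x m = t := by
  constructor
  · intro h
    rw [laguerreL_eq_nodal hx h0, eval_mul, eval_C, Lagrange.eval_nodal] at h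
    rcases mul_eq_zero.1 h with h | h
    · exact absurd h (coeff_laguerreL_self_ne_zero n hα)
    · obtain ⟨m, _, hm⟩ := Finset.prod_eq_zero_iff.1 h
      exact ⟨m, (sub_eq_zero.1 hm).symm⟩
  · rintro ⟨m, rfl⟩
    exact h0 m

theorem eval_derivative_laguerreL_ne_zero {n : ℕ} {α : ℝ} (hα : -1 < α) {x : Fin n → ℝ}
    (hx : Function.Injective x) (h0 : ∀ m, (laguerreL n α).eval (x m) = 0) (m : Fin n) :
    (derivative (laguerreL n α)).eval (x m) ≠ 0 := by
  rw [laguerreL_eq_nodal hx h0, derivative_C_mul, eval_mul, eval_C,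
    Lagrange.eval_nodal_derivative_eval_node_eq (Finset.mem_univ m), Lagrange.eval_nodal]
  refine mul_ne_zero (coeff_laguerreL_self_ne_zero n hα) (Finset.prod_ne_zero_iff.2 fun i hi => ?_)
  exact sub_ne_zero.2 fun h => (Finset.ne_of_mem_erase hi) (hx h).symm

/-! ### Principal values of polynomials times the weight -/

theorem integrableOn_eval_mul_laguerreWeight {α : ℝ} (hα : -1 < α) (P : ℝ[X]) :
    IntegrableOn (fun t => P.eval t * laguerreWeight α t) (Ioi 0) := by
  induction P using Polynomial.induction_on' with
  | add p q hp hq =>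
    simp only [eval_add, add_mul]
    exact hp.add hq
  | monomial k a =>
    have hk : (0 : ℝ) ≤ k := k.cast_nonneg
    refine IntegrableOn.congr_fun ((integrableOn_laguerreWeight (α := α + k)
      (by linarith)).const_mul a) (fun t ht => ?_) measurableSet_Ioi
    rw [eval_monomial, laguerreWeight, laguerreWeight, rpow_add ht, rpow_natCast]
    ring

/-- Each factor `t` adds a constant moment. The shape of the value matters: it is visibly continuous
in `x`, as needed at the nodes. -/
theorem exists_hasCauchyPV_eval_mul_laguerreWeight {α : ℝ} (hα : -1 < α)
    (hα' : ∀ k : ℕ, α ≠ k) (P : ℝ[X]) : ∃ R : ℝ[X], ∀ x > 0,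
      HasCauchyPV (fun t => P.eval t * laguerreWeight α t) x
        (P.eval x * weightPV α x + R.eval x) := by
  induction P using Polynomial.induction_on with
  | C a =>
    refine ⟨0, fun x hx => ?_⟩
    simp only [eval_C, eval_zero, add_zero]
    exact (hasCauchyPV_laguerreWeight hα hα' hx).const_mul a
  | add p q hp hq =>
    obtain ⟨R, hR⟩ := hp
    obtain ⟨S, hS⟩ := hq
    refine ⟨R + S, fun x hx => ?_⟩
    convert (hR x hx).add (hS x hx) using 1
    · ext t; rw [eval_add, add_mul]
    · rw [eval_add, eval_add]; ring
  | monomial n a h =>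
    obtain ⟨R, hR⟩ := h
    refine ⟨R * X + C (∫ t in Ioi 0, (C a * X ^ n).eval t * laguerreWeight α t), fun x hx => ?_⟩
    convert (hR x hx).id_mul (integrableOn_eval_mul_laguerreWeight hα _) using 1
    · ext t; rw [pow_succ, ← mul_assoc, eval_mul_X]; ring
    · rw [pow_succ, ← mul_assoc, eval_mul_X, eval_add, eval_mul_X, eval_C]; ring

/-- Induction on `n` for all `α` at once: `L_{n+1}^α` is a combination of `L_n^α` and `t L_n^{α+1}`,
and `t` is absorbed into the weight of parameter `α + 1`. On the side of `Q`, the match is Kummer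
contiguity. -/
theorem hasCauchyPV_laguerreL {α : ℝ} (hα : -1 < α) (hα' : ∀ k : ℕ, α ≠ k) (n : ℕ) {x : ℝ}
    (hx : 0 < x) :
    HasCauchyPV (fun t => (laguerreL n α).eval t * laguerreWeight α t) x
      (π * laguerreQ n α x) := by
  induction n generalizing α with
  | zero =>
    have h := hasCauchyPV_laguerreWeight hα hα' hx
    have hv : weightPV α x = π * laguerreQ 0 α x := by
      rw [weightPV, laguerreQ, laguerreL_zero hα, Nat.cast_zero, neg_zero, zero_sub, eval_one]
      field_simp
    rw [hv] at h
    exact h.congr fun t _ => by rw [laguerreL_zero hα, eval_one, one_mul]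
  | succ n ih =>
    have hn : (n : ℝ) + 1 ≠ 0 := by positivity
    have hα1 : ∀ k : ℕ, α + 1 ≠ k := fun k hk => by
      rcases k with _ | k
      · push_cast at hk; linarith
      · exact hα' k (by push_cast at hk; linarith)
    have h0 : α ≠ 0 := by simpa using hα' 0
    have hL := X_mul_laguerreL_add_one n hα
    have h := (((ih hα hα').const_mul ((n : ℝ) + α + 1)).sub
      (ih (α := α + 1) (by linarith) hα1)).const_mul ((n : ℝ) + 1)⁻¹
    have hv : ((n : ℝ) + 1)⁻¹ * ((n + α + 1) * (π * laguerreQ n α x) - π * laguerreQ n (α + 1) x)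
        = π * laguerreQ (n + 1) α x := by
      have hk := kummerPhi_contiguous (a := -n - α) (c := 1 - α)
        (fun k h => hα' k (by linarith)) x
      have hLx := congrArg (eval x) hL
      simp only [eval_sub, eval_mul, eval_C, eval_X] at hLx
      rw [show -(n : ℝ) - α - 1 = -((n + 1 : ℕ) : ℝ) - α by push_cast; ring,
        show 1 - α - 1 = 1 - (α + 1) by ring] at hk
      have hk' : kummerPhi (-((n + 1 : ℕ) : ℝ) - α) (1 - (α + 1)) x
          = kummerPhi (-(n : ℝ) - (α + 1)) (1 - (α + 1)) x := by
        congr 1; push_cast; ring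
      rw [hk'] at hk
      simp only [laguerreQ]
      rw [cot_pi_mul_add_one, rpow_add_one hx.ne', Real.Gamma_add_one h0]
      generalize Real.cot (π * α) = κ
      field_simp
      linear_combination (-Real.Gamma α) * hk + κ * x ^ α * π * hLx
    rw [hv] at h
    refine h.congr fun t ht => ?_
    have hLt := congrArg (eval t) hL
    simp only [eval_sub, eval_mul, eval_C, eval_X] at hLt
    rw [laguerreWeight_add_one ht]
    field_simp
    linear_combination (-laguerreWeight α t) * hLt

theorem hasDerivAt_laguerreQ (n : ℕ) (α : ℝ) {x : ℝ} (hx : 0 < x) :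
    HasDerivAt (laguerreQ n α)
      (1 / π * exp (-x) * Real.Gamma α *
          ((n + α) / (α - 1) * kummerPhi (-n - α + 1) (2 - α) x - kummerPhi (-n - α) (1 - α) x)
        - Real.cot (π * α) * x ^ (α - 1) * exp (-x) * (α * (laguerreL n α).eval x
          - x * (laguerreL n α).eval x + x * (derivative (laguerreL n α)).eval x)) x := by
  have h1 := ((hasDerivAt_neg x).exp.const_mul (Real.Gamma α / π)).mul
    (hasDerivAt_kummerPhi (-n - α) (1 - α) x)
  have h2 := (((hasDerivAt_rpow_const (p := α) (Or.inl hx.ne')).const_mul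
    (Real.cot (π * α))).mul (hasDerivAt_neg x).exp).mul ((laguerreL n α).hasDerivAt x)
  refine (h1.sub h2).congr_deriv ?_
  have h3 : (-(n : ℝ) - α) / (1 - α) = (n + α) / (α - 1) := by
    rw [← neg_div_neg_eq]; ring_nf
  have h4 : x ^ α = x ^ (α - 1) * x := by rw [← rpow_add_one hx.ne', sub_add_cancel]
  rw [h3, show 1 - α + 1 = 2 - α by ring]
  simp only [Pi.mul_apply]
  rw [h4]
  ring

theorem hasDerivAt_laguerreQ_of_eval_eq_zero {n : ℕ} (hn : 1 ≤ n) {α : ℝ} (hα : -1 < α) {x : ℝ}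
    (hx : 0 < x) (h0 : (laguerreL n α).eval x = 0) :
    HasDerivAt (laguerreQ n α)
      (1 / π * exp (-x) * Real.Gamma α *
          ((n + α) / (α - 1) * kummerPhi (-n - α + 1) (2 - α) x - kummerPhi (-n - α) (1 - α) x)
        + Real.cot (π * α) * x ^ (α - 1) * exp (-x) * (n + α)
            * (laguerreL (n - 1) α).eval x) x := by
  refine (hasDerivAt_laguerreQ n α hx).congr_deriv ?_
  obtain ⟨m, rfl⟩ := Nat.exists_eq_add_of_le' hn
  have h := congrArg (eval x) (X_mul_derivative_laguerreL m hα)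
  simp only [eval_sub, eval_mul, eval_C, eval_X] at h
  rw [Nat.add_sub_cancel, h, h0]
  push_cast
  ring

theorem continuousAt_weightPV (α : ℝ) {x : ℝ} (hx : 0 < x) : ContinuousAt (weightPV α) x := by
  have h1 := (hasDerivAt_kummerPhi (-α) (1 - α) x).continuousAt
  have h2 : ContinuousAt (fun x : ℝ => x ^ α) x := continuousAt_rpow_const _ _ (Or.inl hx.ne')
  have h3 : ContinuousAt (fun x : ℝ => exp (-x)) x := by fun_prop
  exact ((h3.const_mul _).mul h1).sub ((h2.const_mul _).mul h3)

/-- Split `t - a = (t-y) + (y-a)` in `L_n = (t-a) q`: the first part gives a constant, the second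
`(y-a)` times the principal value sought. -/
theorem hasCauchyPV_divByMonic_laguerreL {n : ℕ} {α : ℝ} (hα : -1 < α)
    (hα' : ∀ k : ℕ, α ≠ k) {a : ℝ} (ha : 0 < a) (h0 : (laguerreL n α).eval a = 0) {y : ℝ}
    (hy : 0 < y) :
    HasCauchyPV (fun t => (laguerreL n α /ₘ (X - C a)).eval t * laguerreWeight α t) y
      (π * dslope (laguerreQ n α) a y) := by
  set q := laguerreL n α /ₘ (X - C a) with hq
  have hLq : (X - C a) * q = laguerreL n α := mul_divByMonic_eq_iff_isRoot.2 h0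
  obtain ⟨R, hR⟩ := exists_hasCauchyPV_eval_mul_laguerreWeight hα hα' q
  set v : ℝ → ℝ := fun y => q.eval y * weightPV α y + R.eval y with hv
  have hint := integrableOn_eval_mul_laguerreWeight hα q
  set c := ∫ t in Ioi 0, q.eval t * laguerreWeight α t with hc
  have hQ : ∀ y > 0, c + (y - a) * v y = π * laguerreQ n α y := fun y hy => by
    refine HasCauchyPV.unique ?_ (hasCauchyPV_laguerreL hα hα' n hy)
    refine ((hasCauchyPV_sub_mul (x := y) hint).add ((hR y hy).const_mul (y - a))).congr
      fun t _ => ?_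
    rw [← hLq, eval_mul, eval_sub, eval_X, eval_C]
    ring
  have hca : c = π * laguerreQ n α a := by simpa using hQ a ha
  have hslope : ∀ y > 0, y ≠ a → slope (laguerreQ n α) a y = π⁻¹ * v y := fun y hy hya => by
    have h1 : y - a ≠ 0 := sub_ne_zero.2 hya
    rw [slope_def_field]
    have h2 := hQ y hy
    rw [hca] at h2
    field_simp
    linear_combination -h2
  -- At `y = a` the identity carries no information on `v a`; it is recovered as the limit of
  -- slopes, `v` being continuous.
  have hderiv : deriv (laguerreQ n α) a = π⁻¹ * v a := by
    have hd := (hasDerivAt_laguerreQ n α ha).differentiableAt.hasDerivAt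
    refine tendsto_nhds_unique (hasDerivAt_iff_tendsto_slope.1 hd) ?_
    have hvc : ContinuousAt (fun y => π⁻¹ * v y) a :=
      ((q.continuous.continuousAt.mul (continuousAt_weightPV α ha)).add
        R.continuous.continuousAt).const_mul _
    refine (hvc.tendsto.mono_left nhdsWithin_le_nhds).congr' ?_
    filter_upwards [self_mem_nhdsWithin, nhdsWithin_le_nhds (lt_mem_nhds ha)] with y hy1 hy2
    exact (hslope y hy2 hy1).symm
  have hval : π * dslope (laguerreQ n α) a y = v y := by
    rcases eq_or_ne y a with rfl | hya
    · rw [dslope_same, hderiv, mul_inv_cancel_left₀ pi_ne_zero]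
    · rw [dslope_of_ne _ hya, hslope y hy hya, mul_inv_cancel_left₀ pi_ne_zero]
  rw [hval]
  exact hR y hy

/-! ### Exactness by Lagrange interpolation -/

theorem eval_derivative_laguerreL_mul_quadGamma {n : ℕ} (hn : 1 ≤ n) {α : ℝ} (hα : -1 < α) {a : ℝ}
    (h0 : (laguerreL n α).eval a = 0) (hd : (derivative (laguerreL n α)).eval a ≠ 0)
    (ha : 0 < a) :
    (laguerreL (n - 1) α).eval a ≠ 0 ∧
      quadGamma n α a * (derivative (laguerreL n α)).eval a = 1 := by
  obtain ⟨m, rfl⟩ := Nat.exists_eq_add_of_le' hn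
  have h := congrArg (eval a) (X_mul_derivative_laguerreL m hα)
  simp only [eval_sub, eval_mul, eval_C, eval_X, h0] at h
  have hm : (m : ℝ) + 1 + α ≠ 0 := by
    have : (0 : ℝ) ≤ m := m.cast_nonneg
    linarith
  have hL : (laguerreL m α).eval a ≠ 0 := by
    intro hL
    rw [hL] at h
    exact mul_ne_zero ha.ne' hd (by linarith)
  rw [quadGamma, Nat.add_sub_cancel]
  refine ⟨hL, ?_⟩
  push_cast
  field_simp
  linarith

/-- This is Lagrange interpolation: `L_n/(t-x_m)` is `L_n'(x_m)` times the basis polynomial of the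
node, and `γ_m` is the inverse of that factor. -/
theorem eq_sum_divByMonic_laguerreL {n : ℕ} (hn : 1 ≤ n) {α : ℝ} (hα : -1 < α) {x : Fin n → ℝ}
    (hx : Function.Injective x) (hpos : ∀ m, 0 < x m) (h0 : ∀ m, (laguerreL n α).eval (x m) = 0)
    {P : ℝ[X]} (hP : P.natDegree ≤ n - 1) :
    P = ∑ m, C (quadGamma n α (x m) * P.eval (x m)) * (laguerreL n α /ₘ (X - C (x m))) := by
  have hdeg : ∀ p : ℝ[X], p.natDegree ≤ n - 1 → p.degree < (Finset.univ : Finset (Fin n)).card :=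
    fun p hp => by
      rw [Finset.card_univ, Fintype.card_fin, degree_lt_iff_coeff_zero]
      exact fun m hm => coeff_eq_zero_of_natDegree_lt (by omega)
  have hLq : ∀ m, (X - C (x m)) * (laguerreL n α /ₘ (X - C (x m))) = laguerreL n α :=
    fun m => mul_divByMonic_eq_iff_isRoot.2 (h0 m)
  refine eq_of_degrees_lt_of_eval_index_eq (Finset.univ : Finset (Fin n)) hx.injOn (hdeg P hP)
    (hdeg _ ?_) fun j _ => ?_
  · refine natDegree_sum_le_of_forall_le _ _ fun m _ => (natDegree_C_mul_le _ _).trans ?_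
    rw [natDegree_divByMonic _ (monic_X_sub_C _), natDegree_X_sub_C]
    exact Nat.sub_le_sub_right (natDegree_laguerreL_le n α) 1
  · rw [eval_finsetSum, Finset.sum_eq_single j]
    · have h := congrArg (fun p => eval (x j) (derivative p)) (hLq j)
      simp only [derivative_mul, derivative_sub, derivative_X, derivative_C, sub_zero, one_mul,
        eval_add, eval_mul, eval_sub, eval_X, eval_C, sub_self, zero_mul, add_zero] at h
      have hγ := (eval_derivative_laguerreL_mul_quadGamma hn hα (h0 j)
        (eval_derivative_laguerreL_ne_zero hα hx h0 j) (hpos j)).2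
      rw [eval_mul, eval_C, h]
      linear_combination (-(P.eval (x j))) * hγ
    · intro m _ hmj
      have h := congrArg (eval (x j)) (hLq m)
      rw [h0 j, eval_mul, eval_sub, eval_X, eval_C] at h
      have h1 : x j - x m ≠ 0 := sub_ne_zero.2 fun h => hmj (hx h).symm
      rw [eval_mul, (mul_eq_zero.1 h).resolve_left h1, mul_zero]
    · exact fun h => absurd (Finset.mem_univ j) h

theorem HasCauchyPV.sum {ι : Type*} {g : ι → ℝ → ℝ} {x : ℝ} {v : ι → ℝ} (s : Finset ι)
    (h : ∀ i ∈ s, HasCauchyPV (g i) x (v i)) :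
    HasCauchyPV (fun t => ∑ i ∈ s, g i t) x (∑ i ∈ s, v i) := by
  classical
  induction s using Finset.induction_on with
  | empty => simpa using hasCauchyPV_of_integrableOn (g := fun _ => 0) (x := x) (by simp)
  | insert i s hi ih =>
    simp only [Finset.sum_insert hi]
    exact (h i (Finset.mem_insert_self i s)).add
      (ih fun j hj => h j (Finset.mem_insert_of_mem hj))

/-- The quadrature formula is exact for polynomials of degree at most `n - 1`. -/
theorem hasCauchyPV_quadrature {n : ℕ} (hn : 1 ≤ n) {α : ℝ} (hα : -1 < α)
    (hα' : ∀ k : ℕ, α ≠ k) {x : Fin n → ℝ} (hx : Function.Injective x) (hpos : ∀ m, 0 < x m)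
    (h0 : ∀ m, (laguerreL n α).eval (x m) = 0) {P : ℝ[X]} (hP : P.natDegree ≤ n - 1) {y : ℝ}
    (hy : 0 < y) :
    HasCauchyPV (fun t => P.eval t * laguerreWeight α t) y
      (π * ∑ m, quadGamma n α (x m) * P.eval (x m) * dslope (laguerreQ n α) (x m) y) := by
  have h := HasCauchyPV.sum Finset.univ fun m (_ : m ∈ Finset.univ) =>
    (hasCauchyPV_divByMonic_laguerreL hα hα' (hpos m) (h0 m) hy).const_mul
      (quadGamma n α (x m) * P.eval (x m))
  rw [Finset.mul_sum]
  convert h using 1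
  · ext t
    conv_lhs => rw [eq_sum_divByMonic_laguerreL hn hα hx hpos h0 hP]
    rw [eval_finsetSum, Finset.sum_mul]
    refine Finset.sum_congr rfl fun m _ => ?_
    rw [eval_mul, eval_C, mul_assoc]
  · exact Finset.sum_congr rfl fun m _ => by ring

/-! ### Existence for Hölder functions of controlled growth -/

theorem integrableOn_abs_sub_rpow {r : ℝ} (hr : -1 < r) (y a b : ℝ) :
    IntegrableOn (fun t : ℝ => |t - y| ^ r) (Icc a b) := by
  have hpos : ∀ c, 0 ≤ c → IntervalIntegrable (fun t : ℝ => |t| ^ r) volume 0 c := fun c hc => by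
    refine (intervalIntegral.intervalIntegrable_rpow' hr).congr_uIoo fun t ht => ?_
    rw [uIoo_of_le hc] at ht
    beta_reduce
    rw [abs_of_pos ht.1]
  have h0 : ∀ c, IntervalIntegrable (fun t : ℝ => |t| ^ r) volume 0 c := fun c => by
    rcases le_total 0 c with hc | hc
    · exact hpos c hc
    · have := (hpos (-c) (by linarith)).comp_sub_left 0
      simpa using this
  have h1 : ∀ c d, IntervalIntegrable (fun t : ℝ => |t| ^ r) volume c d :=
    fun c d => (h0 c).symm.trans (h0 d)
  rcases le_total a b with hab | hab
  · have := (h1 (a - y) (b - y)).comp_sub_right y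
    rw [sub_add_cancel, sub_add_cancel] at this
    rw [integrableOn_Icc_iff_integrableOn_Ioc]
    exact (intervalIntegrable_iff_integrableOn_Ioc_of_le hab).1 this
  · refine IntegrableOn.mono_set (t := {b}) (by simp) fun t ht => ?_
    exact le_antisymm ht.2 (hab.trans ht.1)

/-- The singularities at `0` and at `y` are separated by cutting at `y/2`; on each piece one factor
is continuous. -/
theorem integrableOn_abs_sub_rpow_mul_laguerreWeight {r α : ℝ} (hr : -1 < r) (hα : -1 < α) {y : ℝ}
    (hy : 0 < y) (A : ℝ) :
    IntegrableOn (fun t => |t - y| ^ r * laguerreWeight α t) (Ioc 0 A) := by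
  have h1 : IntegrableOn (fun t => |t - y| ^ r * laguerreWeight α t) (Icc 0 (y / 2)) := by
    refine IntegrableOn.continuousOn_mul ?_ ?_ isCompact_Icc
    · refine ContinuousOn.rpow_const (by fun_prop) fun t ht => Or.inl (abs_ne_zero.2 ?_)
      linarith [ht.2]
    · rw [integrableOn_Icc_iff_integrableOn_Ioc]
      exact (integrableOn_laguerreWeight hα).mono_set Ioc_subset_Ioi_self
  have h2 : IntegrableOn (fun t => |t - y| ^ r * laguerreWeight α t) (Icc (y / 2) A) := by
    refine IntegrableOn.mul_continuousOn (integrableOn_abs_sub_rpow hr y _ _) ?_ isCompact_Icc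
    refine ContinuousOn.mul (ContinuousOn.rpow_const continuousOn_id fun t ht => Or.inl ?_)
      (by fun_prop)
    have : y / 2 ≤ t := ht.1
    exact (by linarith : (0 : ℝ) < t).ne'
  refine (h1.union h2).mono_set fun t ht => ?_
  rcases le_total t (y / 2) with h | h
  · exact Or.inl ⟨ht.1.le, h⟩
  · exact Or.inr ⟨h, ht.2⟩

/-- On `(0, A]` the Hölder bound leaves `|t-y|^(s-1) w(t)` with `s > 0`. Beyond `A ≥ y + 1` the
denominator is at least `1`, and `β < 1` leaves exponential decay. -/
theorem integrableOn_sub_mul_laguerreWeight_div {α : ℝ} (hα : -1 < α) {f : ℝ → ℝ}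
    (hf : ∀ a > 0, ∃ K s : NNReal, 0 < s ∧ HolderOnWith K s f (Icc 0 a))
    (hgrow : ∃ K β : ℝ, β < 1 ∧ ∀ᶠ t in atTop, |f t| ≤ K * exp (β * t)) {y : ℝ} (hy : 0 < y) :
    IntegrableOn (fun t => (f t - f y) * laguerreWeight α t / (t - y)) (Ioi 0) := by
  have hcont : ContinuousOn f (Ioi 0) := fun t ht => by
    have ht' : 0 < t := ht
    obtain ⟨K, s, hs, h⟩ := hf (t + 1) (by linarith)
    exact ((h.continuousOn hs).continuousAt
      (Icc_mem_nhds ht' (by linarith))).continuousWithinAt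
  have hmw : Measurable (laguerreWeight α) := by
    unfold laguerreWeight
    fun_prop
  have hw0 : ∀ t, 0 < t → 0 ≤ laguerreWeight α t := fun t ht =>
    mul_nonneg (rpow_nonneg ht.le _) (exp_pos _).le
  have hmeas : AEStronglyMeasurable (fun t => (f t - f y) * laguerreWeight α t / (t - y))
      (volume.restrict (Ioi 0)) := by
    have h1 := (hcont.aestronglyMeasurable (μ := volume) measurableSet_Ioi).aemeasurable
    exact (((h1.sub_const _).mul hmw.aemeasurable).div
      (by fun_prop : Measurable fun t : ℝ => t - y).aemeasurable).aestronglyMeasurable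
  obtain ⟨K, β, hβ, hK⟩ := hgrow
  obtain ⟨A, hA⟩ := eventually_atTop.1 (hK.and (eventually_ge_atTop (y + 1)))
  have hAy : y + 1 ≤ A := (hA A le_rfl).2
  obtain ⟨H, s, hs, hH⟩ := hf A (by linarith)
  rw [← Ioc_union_Ioi_eq_Ioi (by linarith : 0 ≤ A)] at hmeas ⊢
  refine IntegrableOn.union ?_ ?_
  · have hs' : (0 : ℝ) < s := by exact_mod_cast hs
    refine Integrable.mono' ((integrableOn_abs_sub_rpow_mul_laguerreWeight (r := s - 1)
      (by linarith) hα hy A).const_mul (H : ℝ))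
      (hmeas.mono_set subset_union_left) ?_
    refine (ae_restrict_iff' measurableSet_Ioc).2 (Eventually.of_forall fun t ht => ?_)
    rcases eq_or_ne t y with rfl | hty
    · simp only [sub_self, zero_mul, zero_div, norm_zero]
      exact mul_nonneg H.2 (mul_nonneg (rpow_nonneg (abs_nonneg _) _) (hw0 t ht.1))
    · have hpos : 0 < |t - y| := abs_pos.2 (sub_ne_zero.2 hty)
      have hd := hH.dist_le ⟨ht.1.le, ht.2⟩ ⟨hy.le, by linarith⟩
      rw [Real.dist_eq, Real.dist_eq] at hd
      rw [norm_div, norm_mul, Real.norm_eq_abs, Real.norm_eq_abs, Real.norm_eq_abs,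
        abs_of_nonneg (hw0 t ht.1), div_le_iff₀ hpos, rpow_sub_one hpos.ne']
      have h0 := mul_le_mul_of_nonneg_right hd (hw0 t ht.1)
      refine h0.trans_eq ?_
      field_simp
  · have h1 := (integrableOn_rpow_mul_exp_neg_mul hα (sub_pos.2 hβ)).const_mul K
    have h2 := (integrableOn_laguerreWeight hα).const_mul |f y|
    have hsub : Ioi A ⊆ Ioi 0 := Ioi_subset_Ioi (by linarith)
    refine Integrable.mono' (IntegrableOn.mono_set (h1.add h2) hsub) (hmeas.mono_set subset_union_right) ?_
    refine (ae_restrict_iff' measurableSet_Ioi).2 (Eventually.of_forall fun t ht => ?_)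
    have htA : A < t := ht
    have ht0 : 0 < t := by linarith
    have hft := (hA t htA.le).1
    have hone : 1 ≤ |t - y| := by rw [abs_of_pos (by linarith)]; linarith
    have he : K * (t ^ α * exp (-((1 - β) * t))) = K * exp (β * t) * laguerreWeight α t := by
      rw [laguerreWeight, show -((1 - β) * t) = β * t + -t by ring, exp_add]
      ring
    have hfy : |f t - f y| ≤ K * exp (β * t) + |f y| := (abs_sub _ _).trans (by linarith)
    simp only [Pi.add_apply]
    rw [he, ← add_mul, norm_div, norm_mul, Real.norm_eq_abs, Real.norm_eq_abs, Real.norm_eq_abs,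
      abs_of_nonneg (hw0 t ht0)]
    exact (div_le_self (mul_nonneg (abs_nonneg _) (hw0 t ht0)) hone).trans
      (mul_le_mul_of_nonneg_right hfy (hw0 t ht0))

theorem exists_hasCauchyPV_mul_laguerreWeight {α : ℝ} (hα : -1 < α) (hα' : ∀ k : ℕ, α ≠ k)
    {f : ℝ → ℝ} (hf : ∀ a > 0, ∃ K s : NNReal, 0 < s ∧ HolderOnWith K s f (Icc 0 a))
    (hgrow : ∃ K β : ℝ, β < 1 ∧ ∀ᶠ t in atTop, |f t| ≤ K * exp (β * t)) {y : ℝ} (hy : 0 < y) :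
    ∃ v, HasCauchyPV (fun t => f t * laguerreWeight α t) y v :=
  ⟨_, (((hasCauchyPV_laguerreWeight hα hα' hy).const_mul (f y)).add (hasCauchyPV_of_integrableOn
    (integrableOn_sub_mul_laguerreWeight_div hα hf hgrow hy))).congr fun t _ => by ring⟩

/-! ### The quadrature formula and its remainder -/

theorem sum_mul_dslope {n : ℕ} {x : Fin n → ℝ} {c : Fin n → ℝ} {Q : ℝ → ℝ} {y : ℝ}
    (hy : ∀ m, y ≠ x m) :
    ∑ m, c m * dslope Q (x m) y = ∑ m, c m * ((Q y - Q (x m)) / (y - x m)) :=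
  Finset.sum_congr rfl fun m _ => by rw [dslope_of_ne _ (hy m), slope_def_field]

theorem sum_mul_dslope_node {n : ℕ} {x : Fin n → ℝ} (hx : Function.Injective x) {c : Fin n → ℝ}
    {Q : ℝ → ℝ} (j : Fin n) :
    ∑ m, c m * dslope Q (x m) (x j) = c j * deriv Q (x j)
      + ∑ m ∈ Finset.univ.erase j, c m * ((Q (x j) - Q (x m)) / (x j - x m)) := by
  rw [← Finset.add_sum_erase _ _ (Finset.mem_univ j), dslope_same]
  congr 1
  refine Finset.sum_congr rfl fun m hm => ?_
  rw [dslope_of_ne _ fun h => Finset.ne_of_mem_erase hm (hx h).symm, slope_def_field]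

theorem theorem6p1 (α : ℝ) (hα : -1 < α) (hα' : ∀ k : ℕ, α ≠ k) (n : ℕ) (hn : 1 ≤ n) :
    -- the zeros `x_1 < … < x_n` of the Laguerre polynomial; the weights are well defined
    ∃ x : Fin n → ℝ, StrictMono x ∧ (∀ m, 0 < x m) ∧
      (∀ t : ℝ, (laguerreL n α).eval t = 0 ↔ ∃ m, x m = t) ∧
      (∀ m, (laguerreL (n - 1) α).eval (x m) ≠ 0) ∧
      -- the derivative of `Q` at the nodes
      (∀ j, HasDerivAt (laguerreQ n α)
        (1 / π * exp (-x j) * Real.Gamma α *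
            ((n + α) / (α - 1) * kummerPhi (-n - α + 1) (2 - α) (x j)
              - kummerPhi (-n - α) (1 - α) (x j))
          + Real.cot (π * α) * x j ^ (α - 1) * exp (-x j) * (n + α)
              * (laguerreL (n - 1) α).eval (x j)) (x j)) ∧
      ∀ f : ℝ → ℝ,
        (∀ a > 0, ∃ K s : NNReal, 0 < s ∧ HolderOnWith K s f (Icc 0 a)) →
        (∃ K β : ℝ, β < 1 ∧ ∀ᶠ t in atTop, |f t| ≤ K * exp (β * t)) →
        -- the principal value exists at every point of the semi-axis
        (∀ y > 0, HasCauchyPV (fun t => f t * laguerreWeight α t) y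
          (cauchyPV (fun t => f t * laguerreWeight α t) y)) ∧
        -- the quadrature formula away from the nodes
        (∀ y > 0, (∀ m, y ≠ x m) →
          cauchyI α f y =
            (∑ m, quadGamma n α (x m) * f (x m)
                * ((laguerreQ n α y - laguerreQ n α (x m)) / (y - x m)))
              + quadRemainder n α x f y) ∧
        -- the quadrature formula at the nodes
        (∀ j, cauchyI α f (x j) =
            quadGamma n α (x j) * f (x j) * deriv (laguerreQ n α) (x j)
              + (∑ m ∈ Finset.univ.erase j, quadGamma n α (x m) * f (x m)
                * ((laguerreQ n α (x j) - laguerreQ n α (x m)) / (x j - x m)))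
              + quadRemainder n α x f (x j)) ∧
        -- exactness for polynomials of degree at most `n - 1`
        ((∃ P : ℝ[X], P.natDegree ≤ n - 1 ∧ ∀ t ≥ 0, f t = P.eval t) →
          ∀ y > 0, quadRemainder n α x f y = 0) ∧
        -- the remainder for `f = M + r`, away from the nodes and at the nodes
        (∀ (M : ℝ[X]) (r : ℝ → ℝ), M.natDegree ≤ n - 1 → (∀ t ≥ 0, f t = M.eval t + r t) →
          (∀ y > 0, HasCauchyPV (fun t => r t * laguerreWeight α t) y
            (cauchyPV (fun t => r t * laguerreWeight α t) y)) ∧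
          (∀ y > 0, (∀ m, y ≠ x m) →
            quadRemainder n α x f y =
              -(∑ m, quadGamma n α (x m) * r (x m) / (y - x m)
                  * (laguerreQ n α y - laguerreQ n α (x m)))
                + cauchyI α r y) ∧
          (∀ j, quadRemainder n α x f (x j) =
              -(quadGamma n α (x j) * r (x j) * deriv (laguerreQ n α) (x j)
                + ∑ m ∈ Finset.univ.erase j, quadGamma n α (x m) * r (x m)
                  * ((laguerreQ n α (x j) - laguerreQ n α (x m)) / (x j - x m)))
                + cauchyI α r (x j))) := by
  obtain ⟨x, hmono, hpos, h0⟩ := exists_zeros_laguerreL n hα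
  have hinj := hmono.injective
  have hd := eval_derivative_laguerreL_ne_zero hα hinj h0
  refine ⟨x, hmono, hpos, eval_laguerreL_eq_zero_iff hα hinj h0,
    fun m => (eval_derivative_laguerreL_mul_quadGamma hn hα (h0 m) (hd m) (hpos m)).1,
    fun j => hasDerivAt_laguerreQ_of_eval_eq_zero hn hα (hpos j) (h0 j), fun f hf hgrow => ?_⟩
  have hpv : ∀ y > 0, HasCauchyPV (fun t => f t * laguerreWeight α t) y
      (cauchyPV (fun t => f t * laguerreWeight α t) y) := fun y hy => by
    obtain ⟨v, hv⟩ := exists_hasCauchyPV_mul_laguerreWeight hα hα' hf hgrow hy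
    exact hv.hasCauchyPV_cauchyPV
  refine ⟨hpv, fun y _ hyx => ?_, fun j => ?_, ?_, fun M r hM hfr => ?_⟩
  · rw [quadRemainder, sum_mul_dslope hyx]
    ring
  · rw [quadRemainder, sum_mul_dslope_node hinj]
    ring
  · rintro ⟨P, hP, hfP⟩ y hy
    have h1 := (hasCauchyPV_quadrature hn hα hα' hinj hpos h0 hP hy).congr
      (h := fun t => f t * laguerreWeight α t) fun t ht => by rw [hfP t ht.le]
    rw [quadRemainder, cauchyI, h1.cauchyPV_eq, one_div, inv_mul_cancel_left₀ pi_ne_zero,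
      sub_eq_zero]
    exact Finset.sum_congr rfl fun m _ => by rw [hfP _ (hpos m).le]
  -- Existence for `r` comes by subtracting the exact formula for `M` from the principal value of
  -- `f`, so no regularity of `r` has to be derived.
  · have hr : ∀ y > 0, HasCauchyPV (fun t => r t * laguerreWeight α t) y
        (cauchyPV (fun t => f t * laguerreWeight α t) y
          - π * ∑ m, quadGamma n α (x m) * M.eval (x m) * dslope (laguerreQ n α) (x m) y) :=
      fun y hy => ((hpv y hy).sub (hasCauchyPV_quadrature hn hα hα' hinj hpos h0 hM hy)).congr
        fun t ht => by rw [hfr t ht.le]; ring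
    have hrem : ∀ y > 0, quadRemainder n α x f y
        = -(∑ m, quadGamma n α (x m) * r (x m) * dslope (laguerreQ n α) (x m) y)
          + cauchyI α r y := fun y hy => by
      have hs : ∑ m, quadGamma n α (x m) * f (x m) * dslope (laguerreQ n α) (x m) y
          = ∑ m, quadGamma n α (x m) * M.eval (x m) * dslope (laguerreQ n α) (x m) y
            + ∑ m, quadGamma n α (x m) * r (x m) * dslope (laguerreQ n α) (x m) y := by
        rw [← Finset.sum_add_distrib]
        exact Finset.sum_congr rfl fun m _ => by rw [hfr _ (hpos m).le]; ring
      rw [quadRemainder, hs, cauchyI, cauchyI, (hr y hy).cauchyPV_eq]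
      field_simp
      ring
    refine ⟨fun y hy => (hr y hy).hasCauchyPV_cauchyPV, fun y hy hyx => ?_, fun j => ?_⟩
    · rw [hrem y hy, sum_mul_dslope hyx]
      congr 2
      exact Finset.sum_congr rfl fun m _ => by ring
    · rw [hrem _ (hpos j), sum_mul_dslope_node hinj]
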